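/- Theorem. Let $n\ge 3$ and let $M$ be a connected (Hausdorff) smooth manifold of real dimension $2n$ with an almost Hermitian structure $(g,J)$: $g$ is a smooth Riemannian metric and $J$ is a smooth field of endomorphisms of the tangent spaces with $J^2=-\mathrm{id}$ and $g(Jx,Jy)=g(x,y)$. Let $\nabla$ be the Levi-Civita connection of $g$, let $R(x,y,z,u)=g(\nabla_x\nabla_y z-\nabla_y\nabla_x z-\nabla_{[x,y]}z,\,u)$ be the curvature tensor, and for a 2-plane $\alpha\subset T_pM$ with orthonormal basis $\{x,y\}$ let $K(\alpha,p)=R(x,y,y,x)$ be its sectional curvature. A 2-plane $\alpha\subset T_pM$ is called antiholomorphic if $J\alpha\perp\alpha$. Suppose that there is a function $\nu:M\to\mathbb R$ such that $K(\alpha,p)=\nu(p)$ for every $p\in M$ and every antiholomorphic 2-plane $\alpha\subset T_pM$. Then $\nu$ is constant on $M$. -/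

import Mathlib

open scoped Manifold ContDiff Bundle

noncomputable section

section RiemannianGeometry

variable {E : Type*} [NormedAddCommGroup E] [NormedSpace ℝ E] [FiniteDimensional ℝ E]
  {H : Type*} [TopologicalSpace H] (I : ModelWithCorners ℝ E H)
  {M : Type*} [TopologicalSpace M] [ChartedSpace H M] [IsManifold I ∞ M]
  [Bundle.RiemannianBundle (fun p : M => TangentSpace I p)]

/-- The right-hand side of the Koszul formula: for differentiable vector fields `X, Y, Z` this is
the value of `g(∇_X Y, Z)` at `p`, where `∇` is the Levi-Civita connection of the metric. -/
def koszulForm (X Y Z : ∀ p : M, TangentSpace I p) (p : M) : ℝ :=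
  (1 / 2 : ℝ) *
    (mvfderiv I (fun q => inner ℝ (Y q) (Z q)) p (X p)
      + mvfderiv I (fun q => inner ℝ (X q) (Z q)) p (Y p)
      - mvfderiv I (fun q => inner ℝ (X q) (Y q)) p (Z p)
      + inner ℝ (VectorField.mlieBracket I X Y p) (Z p)
      - inner ℝ (VectorField.mlieBracket I X Z p) (Y p)
      - inner ℝ (VectorField.mlieBracket I Y Z p) (X p))

/-- The Levi-Civita derivative `∇_X Y` of vector fields. Its value at `p` is the tangent vector
`∑ᵢ g(∇_X Y, eᵢ) eᵢ`, with `(eᵢ)` an orthonormal basis of `T_pM` and the coefficients given by the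
Koszul formula; `FiberBundle.extend E e` is a vector field, smooth near `p`, with value `e`
at `p`. -/
def leviCivita (X Y : ∀ p : M, TangentSpace I p) (p : M) : TangentSpace I p :=
  haveI : FiniteDimensional ℝ (TangentSpace I p) := inferInstanceAs (FiniteDimensional ℝ E)
  let e := stdOrthonormalBasis ℝ (TangentSpace I p)
  ∑ i, koszulForm I X Y (FiberBundle.extend E (e i)) p • e i

/-- The curvature operator `R(X,Y)Z = ∇_X ∇_Y Z - ∇_Y ∇_X Z - ∇_{[X,Y]} Z` on vector fields. -/
def curvatureOperator (X Y Z : ∀ p : M, TangentSpace I p) (p : M) : TangentSpace I p :=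
  leviCivita I X (leviCivita I Y Z) p - leviCivita I Y (leviCivita I X Z) p
    - leviCivita I (VectorField.mlieBracket I X Y) Z p

/-- The curvature tensor `R(x,y,z,u) = g(R(x,y)z, u)` at `p`. The tangent vectors `x, y, z` are
extended to vector fields that are smooth near `p`. -/
def curvatureTensor {p : M} (x y z u : TangentSpace I p) : ℝ :=
  inner ℝ (curvatureOperator I (FiberBundle.extend E x) (FiberBundle.extend E y)
    (FiberBundle.extend E z) p) u

/-- `k` is the sectional curvature `K(α,p)` of the 2-plane `α ⊆ T_pM`: it is `R(x,y,y,x)` for the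
orthonormal bases `x, y` of `α`. -/
def HasSectionalCurvature {p : M} (α : Submodule ℝ (TangentSpace I p)) (k : ℝ) : Prop :=
  Module.finrank ℝ α = 2 ∧
    ∀ x y : TangentSpace I p, Orthonormal ℝ ![x, y] → Submodule.span ℝ {x, y} = α →
      curvatureTensor I x y y x = k

/-- The field of endomorphisms `J` is an almost Hermitian structure for the Riemannian metric
of `M`: a smooth almost complex structure that is orthogonal on each tangent space. -/
structure IsAlmostHermitian (J : ∀ p : M, TangentSpace I p →L[ℝ] TangentSpace I p) : Prop where
  smooth : ContMDiff I (I.prod 𝓘(ℝ, E →L[ℝ] E)) ∞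
    (fun p => (Bundle.TotalSpace.mk' (E →L[ℝ] E) p (J p) :
      Bundle.TotalSpace (E →L[ℝ] E) (fun p : M => TangentSpace I p →L[ℝ] TangentSpace I p)))
  sq : ∀ (p : M) (x : TangentSpace I p), J p (J p x) = -x
  orthogonal : ∀ (p : M) (x y : TangentSpace I p), inner ℝ (J p x) (J p y) = inner ℝ x y

variable {I} in
/-- The 2-plane `α ⊆ T_pM` is antiholomorphic: `Jα ⊥ α`. -/
def IsAntiholomorphicPlane (J : ∀ p : M, TangentSpace I p →L[ℝ] TangentSpace I p) {p : M}
    (α : Submodule ℝ (TangentSpace I p)) : Prop :=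
  Module.finrank ℝ α = 2 ∧ ∀ x ∈ α, ∀ y ∈ α, inner ℝ (J p x) y = 0

/-- `M` is of pointwise constant antiholomorphic sectional curvature `ν`: at each point `p`, every
antiholomorphic 2-plane in `T_pM` has sectional curvature `ν p`. -/
def HasPointwiseConstantAntiholomorphicCurvature
    (J : ∀ p : M, TangentSpace I p →L[ℝ] TangentSpace I p) (ν : M → ℝ) : Prop :=
  ∀ (p : M) (α : Submodule ℝ (TangentSpace I p)),
    IsAntiholomorphicPlane J α → HasSectionalCurvature I α (ν p)

end RiemannianGeometry

end

section VectorFields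

set_option linter.unusedSectionVars false

variable {E : Type*} [NormedAddCommGroup E] [NormedSpace ℝ E] [FiniteDimensional ℝ E]
  {H : Type*} [TopologicalSpace H] {I : ModelWithCorners ℝ E H}
  {M : Type*} [TopologicalSpace M] [ChartedSpace H M] [IsManifold I ∞ M]

open Filter Topology VectorField

variable (I) in
/-- A vector field is smooth at a point. -/
def SmoothFieldAt (X : ∀ p : M, TangentSpace I p) (p : M) : Prop :=
  ContMDiffAt I (I.prod 𝓘(ℝ, E)) ∞ (fun q => (⟨q, X q⟩ : TangentBundle I M)) p

variable (I) in
/-- A vector field is differentiable at a point. -/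
def DiffFieldAt (X : ∀ p : M, TangentSpace I p) (p : M) : Prop :=
  MDifferentiableAt I (I.prod 𝓘(ℝ, E)) (fun q => (⟨q, X q⟩ : TangentBundle I M)) p

variable {X Y Z : ∀ p : M, TangentSpace I p} {f h : M → ℝ} {p : M}

theorem SmoothFieldAt.diffFieldAt (hX : SmoothFieldAt I X p) : DiffFieldAt I X p :=
  ContMDiffAt.mdifferentiableAt hX (by simp)

theorem SmoothFieldAt.eventually_diffFieldAt (hX : SmoothFieldAt I X p) :
    ∀ᶠ q in 𝓝 p, DiffFieldAt I X q := by
  have h1 : ContMDiffAt I (I.prod 𝓘(ℝ, E)) 1 (fun q => (⟨q, X q⟩ : TangentBundle I M)) p :=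
    ContMDiffAt.of_le hX (by simp)
  filter_upwards [(contMDiffAt_iff_contMDiffAt_nhds (by simp)).1 h1] with q hq
  exact hq.mdifferentiableAt (by simp)

theorem eventually_mdifferentiableAt (hf : ContMDiffAt I 𝓘(ℝ) ∞ f p) :
    ∀ᶠ q in 𝓝 p, MDifferentiableAt I 𝓘(ℝ) f q := by
  have h1 : ContMDiffAt I 𝓘(ℝ) 1 f p := hf.of_le (by simp)
  filter_upwards [(contMDiffAt_iff_contMDiffAt_nhds (by simp)).1 h1] with q hq
  exact hq.mdifferentiableAt (by simp)

theorem SmoothFieldAt.congr (hX : SmoothFieldAt I X p) (h : ∀ᶠ q in 𝓝 p, Y q = X q) :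
    SmoothFieldAt I Y p :=
  ContMDiffAt.congr_of_eventuallyEq hX (h.mono fun q hq => by simp [hq])

protected theorem SmoothFieldAt.add (hX : SmoothFieldAt I X p) (hY : SmoothFieldAt I Y p) :
    SmoothFieldAt I (X + Y) p := ContMDiffAt.add_section hX hY

protected theorem SmoothFieldAt.sub (hX : SmoothFieldAt I X p) (hY : SmoothFieldAt I Y p) :
    SmoothFieldAt I (X - Y) p := ContMDiffAt.sub_section hX hY

protected theorem SmoothFieldAt.smul (hf : ContMDiffAt I 𝓘(ℝ) ∞ f p) (hX : SmoothFieldAt I X p) :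
    SmoothFieldAt I (f • X) p := ContMDiffAt.smul_section hf hX

protected theorem DiffFieldAt.add (hX : DiffFieldAt I X p) (hY : DiffFieldAt I Y p) :
    DiffFieldAt I (X + Y) p := mdifferentiableAt_add_section hX hY

protected theorem DiffFieldAt.sub (hX : DiffFieldAt I X p) (hY : DiffFieldAt I Y p) :
    DiffFieldAt I (X - Y) p := mdifferentiableAt_sub_section hX hY

protected theorem DiffFieldAt.smul (hf : MDifferentiableAt I 𝓘(ℝ) f p) (hX : DiffFieldAt I X p) :
    DiffFieldAt I (f • X) p := MDifferentiableAt.smul_section hf hX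

theorem eventually_smoothFieldAt_extend (v : TangentSpace I p) :
    ∀ᶠ q in 𝓝 p, SmoothFieldAt I (FiberBundle.extend E v) q := by
  obtain ⟨s, hs, h⟩ := FiberBundle.exists_contMDiffOn_extend (k := ∞) I E v
  filter_upwards [eventually_mem_nhds_iff.2 hs] with q hq
  exact ContMDiffOn.contMDiffAt h hq

theorem smoothFieldAt_extend (v : TangentSpace I p) :
    SmoothFieldAt I (FiberBundle.extend E v) p :=
  (eventually_smoothFieldAt_extend v).self_of_nhds

theorem isManifold_minSmoothness_two : IsManifold I (minSmoothness ℝ 2) M := by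
  rw [minSmoothness_of_isRCLikeNormedField]; infer_instance

theorem isManifold_minSmoothness_three : IsManifold I (minSmoothness ℝ 3) M := by
  rw [minSmoothness_of_isRCLikeNormedField]; infer_instance

attribute [local instance] isManifold_minSmoothness_two isManifold_minSmoothness_three

protected theorem SmoothFieldAt.mlieBracket (hX : SmoothFieldAt I X p) (hY : SmoothFieldAt I Y p) :
    SmoothFieldAt I (mlieBracket I X Y) p := by
  have : CompleteSpace E := FiniteDimensional.complete ℝ E
  have : IsManifold I (((⊤ : ℕ∞) : ℕ∞ω) + 1) M := by
    rw [show (((⊤ : ℕ∞) : ℕ∞ω) + 1) = ∞ from rfl]; infer_instance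
  refine ContMDiffAt.mlieBracket_vectorField (m := ⊤) (n := ⊤) hX hY ?_
  rw [minSmoothness_of_isRCLikeNormedField]; exact le_of_eq rfl

theorem SmoothFieldAt.jacobi (hX : SmoothFieldAt I X p) (hY : SmoothFieldAt I Y p)
    (hZ : SmoothFieldAt I Z p) :
    mlieBracket I X (mlieBracket I Y Z) p =
      mlieBracket I (mlieBracket I X Y) Z p + mlieBracket I Y (mlieBracket I X Z) p := by
  have : CompleteSpace E := FiniteDimensional.complete ℝ E
  apply leibniz_identity_mlieBracket_apply <;> rw [minSmoothness_of_isRCLikeNormedField]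
  exacts [ContMDiffAt.of_le hX ENat.LEInfty.out, ContMDiffAt.of_le hY ENat.LEInfty.out,
    ContMDiffAt.of_le hZ ENat.LEInfty.out]

protected theorem DiffFieldAt.mlieBracket_smul_right (hf : MDifferentiableAt I 𝓘(ℝ) f p)
    (hY : DiffFieldAt I Y p) :
    mlieBracket I X (f • Y) p = mvfderiv I f p (X p) • Y p + f p • mlieBracket I X Y p := by
  have : CompleteSpace E := FiniteDimensional.complete ℝ E
  exact VectorField.mlieBracket_smul_right hf hY

protected theorem DiffFieldAt.mlieBracket_smul_left (hf : MDifferentiableAt I 𝓘(ℝ) f p)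
    (hX : DiffFieldAt I X p) :
    mlieBracket I (f • X) Y p = - mvfderiv I f p (Y p) • X p + f p • mlieBracket I X Y p := by
  have : CompleteSpace E := FiniteDimensional.complete ℝ E
  exact VectorField.mlieBracket_smul_left hf hX

protected theorem DiffFieldAt.mlieBracket_add_right (hY : DiffFieldAt I Y p) (hZ : DiffFieldAt I Z p) :
    mlieBracket I X (Y + Z) p = mlieBracket I X Y p + mlieBracket I X Z p := by
  have : CompleteSpace E := FiniteDimensional.complete ℝ E
  exact VectorField.mlieBracket_add_right hY hZ

protected theorem DiffFieldAt.mlieBracket_add_left (hY : DiffFieldAt I Y p) (hZ : DiffFieldAt I Z p) :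
    mlieBracket I (Y + Z) X p = mlieBracket I Y X p + mlieBracket I Z X p := by
  have : CompleteSpace E := FiniteDimensional.complete ℝ E
  exact VectorField.mlieBracket_add_left hY hZ

variable [Bundle.RiemannianBundle (fun p : M => TangentSpace I p)]
  [IsContMDiffRiemannianBundle I ∞ E (fun p : M => TangentSpace I p)]

protected theorem SmoothFieldAt.inner (hX : SmoothFieldAt I X p) (hY : SmoothFieldAt I Y p) :
    ContMDiffAt I 𝓘(ℝ) ∞ (fun q => inner ℝ (X q) (Y q)) p :=
  ContMDiffAt.inner_bundle hX hY

protected theorem DiffFieldAt.inner (hX : DiffFieldAt I X p) (hY : DiffFieldAt I Y p) :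
    MDifferentiableAt I 𝓘(ℝ) (fun q => inner ℝ (X q) (Y q)) p :=
  MDifferentiableAt.inner_bundle hX hY

theorem exists_smoothFieldAt_ne_zero [Nontrivial E] (p : M) :
    ∃ Z : ∀ p : M, TangentSpace I p, SmoothFieldAt I Z p ∧ Z p ≠ 0 := by
  obtain ⟨z, hz⟩ := exists_ne (0 : E)
  exact ⟨FiberBundle.extend E (show TangentSpace I p from z), smoothFieldAt_extend _, by
    rw [FiberBundle.extend_apply_self]; exact hz⟩

theorem SmoothFieldAt.mvfderiv_apply [Nontrivial E] (hX : SmoothFieldAt I X p)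
    (hf : ContMDiffAt I 𝓘(ℝ) ∞ f p) :
    ContMDiffAt I 𝓘(ℝ) ∞ (fun q => mvfderiv I f q (X q)) p := by
  obtain ⟨Z, hZ, hZp⟩ := exists_smoothFieldAt_ne_zero (I := I) p
  have h1 := ((hX.mlieBracket (hZ.smul hf)).sub ((hX.mlieBracket hZ).smul hf)).inner hZ
  have h2 := hZ.inner hZ
  have hne : inner ℝ (Z p) (Z p) ≠ (0 : ℝ) := by simpa using hZp
  have h3 : ∀ᶠ q in 𝓝 p, inner ℝ (Z q) (Z q) ≠ (0 : ℝ) :=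
    h2.continuousAt.eventually_ne hne
  refine (h1.div₀ h2 hne).congr_of_eventuallyEq ?_
  filter_upwards [h3, hZ.eventually_diffFieldAt, eventually_mdifferentiableAt hf] with q hq hZq hfq
  simp only [Pi.div_apply, Pi.sub_apply, Pi.smul_apply', hZq.mlieBracket_smul_right hfq]
  rw [add_sub_cancel_right, real_inner_smul_left, mul_div_assoc, div_self hq, mul_one]

theorem mvfderiv_congr (hfh : f =ᶠ[𝓝 p] h) : mvfderiv I f p = mvfderiv I h p := by
  unfold mvfderiv
  rw [hfh.mfderiv_eq]
  rfl

theorem mvfderiv_mlieBracket [Nontrivial E] (hX : SmoothFieldAt I X p) (hY : SmoothFieldAt I Y p)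
    (hf : ContMDiffAt I 𝓘(ℝ) ∞ f p) :
    mvfderiv I f p (mlieBracket I X Y p) =
      mvfderiv I (fun q => mvfderiv I f q (Y q)) p (X p)
        - mvfderiv I (fun q => mvfderiv I f q (X q)) p (Y p) := by
  obtain ⟨Z, hZ, hZp⟩ := exists_smoothFieldAt_ne_zero (I := I) p
  have hfp := hf.mdifferentiableAt (by simp)
  have expand : ∀ {X Y : ∀ p : M, TangentSpace I p}, SmoothFieldAt I X p → SmoothFieldAt I Y p →
      mlieBracket I X (mlieBracket I Y (f • Z)) p =
        (mvfderiv I (fun q => mvfderiv I f q (Y q)) p (X p) • Z p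
          + mvfderiv I f p (Y p) • mlieBracket I X Z p)
        + (mvfderiv I f p (X p) • mlieBracket I Y Z p
          + f p • mlieBracket I X (mlieBracket I Y Z) p) := by
    intro X Y hX hY
    have he : mlieBracket I Y (f • Z) =ᶠ[𝓝 p]
        ((fun q => mvfderiv I f q (Y q)) • Z + f • mlieBracket I Y Z) := by
      filter_upwards [hZ.eventually_diffFieldAt, eventually_mdifferentiableAt hf] with q hZq hfq
      rw [hZq.mlieBracket_smul_right hfq]; rfl
    have hYf := (hY.mvfderiv_apply hf).mdifferentiableAt (by simp)
    rw [Filter.EventuallyEq.mlieBracket_vectorField_eq (EventuallyEq.refl _ X) he,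
      DiffFieldAt.mlieBracket_add_right (hZ.diffFieldAt.smul hYf)
        ((hY.mlieBracket hZ).diffFieldAt.smul hfp),
      hZ.diffFieldAt.mlieBracket_smul_right hYf,
      (hY.mlieBracket hZ).diffFieldAt.mlieBracket_smul_right hfp]
  have J1 := hX.jacobi hY (hZ.smul hf)
  rw [expand hX hY, expand hY hX, hZ.diffFieldAt.mlieBracket_smul_right hfp, hX.jacobi hY hZ] at J1
  have J2 : (mvfderiv I (fun q => mvfderiv I f q (Y q)) p (X p)
      - mvfderiv I (fun q => mvfderiv I f q (X q)) p (Y p)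
      - mvfderiv I f p (mlieBracket I X Y p)) • Z p = 0 := by
    rw [← sub_eq_zero] at J1
    rw [← J1]
    module
  have := (smul_eq_zero.1 J2).resolve_right hZp
  linarith

end VectorFields

section LeviCivita

set_option linter.unusedSectionVars false
set_option linter.unusedSimpArgs false

variable {E : Type*} [NormedAddCommGroup E] [NormedSpace ℝ E] [FiniteDimensional ℝ E]
  {H : Type*} [TopologicalSpace H] {I : ModelWithCorners ℝ E H}
  {M : Type*} [TopologicalSpace M] [ChartedSpace H M] [IsManifold I ∞ M]
  [Bundle.RiemannianBundle (fun p : M => TangentSpace I p)]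
  [IsContMDiffRiemannianBundle I ∞ E (fun p : M => TangentSpace I p)]

open Filter Topology VectorField

variable {X Y Z X' Y' Z' : ∀ p : M, TangentSpace I p} {f : M → ℝ} {p : M}

theorem koszulForm_congr (hX : X =ᶠ[𝓝 p] X') (hY : Y =ᶠ[𝓝 p] Y') (hZ : Z =ᶠ[𝓝 p] Z') :
    koszulForm I X Y Z p = koszulForm I X' Y' Z' p := by
  unfold koszulForm
  rw [Filter.EventuallyEq.mlieBracket_vectorField_eq hX hY,
    Filter.EventuallyEq.mlieBracket_vectorField_eq hX hZ,
    Filter.EventuallyEq.mlieBracket_vectorField_eq hY hZ,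
    hX.self_of_nhds, hY.self_of_nhds, hZ.self_of_nhds,
    mvfderiv_congr (f := fun q => inner ℝ (Y q) (Z q)) (h := fun q => inner ℝ (Y' q) (Z' q))
      (by filter_upwards [hY, hZ] with q h1 h2; rw [h1, h2]),
    mvfderiv_congr (f := fun q => inner ℝ (X q) (Z q)) (h := fun q => inner ℝ (X' q) (Z' q))
      (by filter_upwards [hX, hZ] with q h1 h2; rw [h1, h2]),
    mvfderiv_congr (f := fun q => inner ℝ (X q) (Y q)) (h := fun q => inner ℝ (X' q) (Y' q))
      (by filter_upwards [hX, hY] with q h1 h2; rw [h1, h2])]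

theorem mvfderiv_inner_add_left (hX : DiffFieldAt I X p) (hY : DiffFieldAt I Y p)
    (hZ : DiffFieldAt I Z p) (v : TangentSpace I p) :
    mvfderiv I (fun q => inner ℝ ((X + Y) q) (Z q)) p v =
      mvfderiv I (fun q => inner ℝ (X q) (Z q)) p v
        + mvfderiv I (fun q => inner ℝ (Y q) (Z q)) p v := by
  have : (fun q => inner ℝ ((X + Y) q) (Z q)) =
      (fun q => inner ℝ (X q) (Z q)) + fun q => inner ℝ (Y q) (Z q) := by
    ext q; simp [inner_add_left]
  rw [this, mvfderiv_add (hX.inner hZ) (hY.inner hZ)]; rfl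

theorem mvfderiv_inner_smul_left (hf : MDifferentiableAt I 𝓘(ℝ) f p) (hX : DiffFieldAt I X p)
    (hZ : DiffFieldAt I Z p) (v : TangentSpace I p) :
    mvfderiv I (fun q => inner ℝ ((f • X) q) (Z q)) p v =
      mvfderiv I f p v * inner ℝ (X p) (Z p)
        + f p * mvfderiv I (fun q => inner ℝ (X q) (Z q)) p v := by
  have : (fun q => inner ℝ ((f • X) q) (Z q)) =
      f * fun q => inner ℝ (X q) (Z q) := by
    ext q; simp [real_inner_smul_left]
  rw [this, mvfderiv_mul hf (hX.inner hZ)]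
  simp
  ring

theorem mvfderiv_inner_comm (v : TangentSpace I p) :
    mvfderiv I (fun q => inner ℝ (X q) (Y q)) p v
      = mvfderiv I (fun q => inner ℝ (Y q) (X q)) p v := by
  simp only [real_inner_comm]

theorem tensorialAt_koszulForm_right (hX : DiffFieldAt I X p) (hY : DiffFieldAt I Y p) :
    TensorialAt I E (fun Z : ∀ p : M, TangentSpace I p => koszulForm I X Y Z p) p where
  smul {f Z} hf hZ := by
    change DiffFieldAt I Z p at hZ
    simp only [koszulForm, hZ.mlieBracket_smul_right hf, mvfderiv_inner_comm (X := X) (Y := f • Z),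
      mvfderiv_inner_comm (X := Y) (Y := f • Z), mvfderiv_inner_smul_left hf hZ hX,
      mvfderiv_inner_smul_left hf hZ hY, mvfderiv_inner_comm (X := X) (Y := Z),
      mvfderiv_inner_comm (X := Y) (Y := Z)]
    simp only [Pi.smul_apply', map_smul, real_inner_smul_right,
      real_inner_smul_left, inner_add_left, smul_eq_mul, real_inner_comm]
    ring
  add {Z Z'} hZ hZ' := by
    change DiffFieldAt I Z p at hZ
    change DiffFieldAt I Z' p at hZ'
    simp only [koszulForm, hZ.mlieBracket_add_right hZ', mvfderiv_inner_comm (X := X) (Y := Z + Z'),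
      mvfderiv_inner_comm (X := Y) (Y := Z + Z'), mvfderiv_inner_add_left hZ hZ' hX,
      mvfderiv_inner_add_left hZ hZ' hY, mvfderiv_inner_comm (X := X) (Y := Z),
      mvfderiv_inner_comm (X := Y) (Y := Z), mvfderiv_inner_comm (X := X) (Y := Z'),
      mvfderiv_inner_comm (X := Y) (Y := Z')]
    simp only [Pi.add_apply, map_add, inner_add_right, inner_add_left]
    ring

theorem koszulForm_add_swap_right (X Y Z : ∀ p : M, TangentSpace I p) (p : M) :
    koszulForm I X Y Z p + koszulForm I X Z Y p
      = mvfderiv I (fun q => inner ℝ (Y q) (Z q)) p (X p) := by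
  simp only [koszulForm, mvfderiv_inner_comm (X := Z) (Y := Y), mlieBracket_swap_apply (V := Z) (W := Y),
    inner_neg_left]
  ring

theorem koszulForm_sub_swap_left (X Y Z : ∀ p : M, TangentSpace I p) (p : M) :
    koszulForm I X Y Z p - koszulForm I Y X Z p = inner ℝ (mlieBracket I X Y p) (Z p) := by
  simp only [koszulForm, mvfderiv_inner_comm (X := Y) (Y := X), mlieBracket_swap_apply (V := Y) (W := X),
    inner_neg_left]
  ring

theorem tensorialAt_koszulForm_left (hY : DiffFieldAt I Y p) (hZ : DiffFieldAt I Z p) :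
    TensorialAt I E (fun X : ∀ p : M, TangentSpace I p => koszulForm I X Y Z p) p where
  smul {f X} hf hX := by
    change DiffFieldAt I X p at hX
    simp only [koszulForm, hX.mlieBracket_smul_left hf, mvfderiv_inner_smul_left hf hX hY,
      mvfderiv_inner_smul_left hf hX hZ]
    simp only [Pi.smul_apply', map_smul, real_inner_smul_right,
      real_inner_smul_left, inner_add_left, smul_eq_mul]
    ring
  add {X X'} hX hX' := by
    change DiffFieldAt I X p at hX
    change DiffFieldAt I X' p at hX'
    simp only [koszulForm, hX.mlieBracket_add_left hX', mvfderiv_inner_add_left hX hX' hY,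
      mvfderiv_inner_add_left hX hX' hZ]
    simp only [Pi.add_apply, map_add, inner_add_right, inner_add_left]
    ring

theorem koszulForm_add_middle (hY : DiffFieldAt I Y p) (hY' : DiffFieldAt I Y' p)
    (hX : DiffFieldAt I X p) (hZ : DiffFieldAt I Z p) :
    koszulForm I X (Y + Y') Z p = koszulForm I X Y Z p + koszulForm I X Y' Z p := by
  have h1 := koszulForm_sub_swap_left X (Y + Y') Z p
  have h2 := koszulForm_sub_swap_left X Y Z p
  have h3 := koszulForm_sub_swap_left X Y' Z p
  have h4 := (tensorialAt_koszulForm_left hX hZ).add hY hY'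
  beta_reduce at h4
  rw [hY.mlieBracket_add_right hY', inner_add_left] at h1
  linarith

theorem inner_leviCivita (hX : DiffFieldAt I X p) (hY : DiffFieldAt I Y p)
    (hZ : DiffFieldAt I Z p) :
    inner ℝ (leviCivita I X Y p) (Z p) = koszulForm I X Y Z p := by
  have : FiniteDimensional ℝ (TangentSpace I p) := inferInstanceAs (FiniteDimensional ℝ E)
  have hT := tensorialAt_koszulForm_right hX hY
  have key : ∀ z, TensorialAt.mkHom _ p hT z = koszulForm I X Y (FiberBundle.extend E z) p :=
    TensorialAt.mkHom_apply_eq_extend hT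
  rw [← TensorialAt.mkHom_apply hT hZ]
  simp only [leviCivita, ← key]
  conv_rhs => rw [← (stdOrthonormalBasis ℝ (TangentSpace I p)).sum_repr (Z p)]
  simp [sum_inner, real_inner_smul_left, OrthonormalBasis.repr_apply_apply, mul_comm]

theorem inner_ext {v w : TangentSpace I p}
    (h : ∀ Z : ∀ p : M, TangentSpace I p, SmoothFieldAt I Z p →
      inner ℝ v (Z p) = inner ℝ w (Z p)) : v = w :=
  ext_inner_right ℝ fun z => by simpa using h _ (smoothFieldAt_extend z)

theorem leviCivita_congr_right (hY : Y =ᶠ[𝓝 p] Y') : leviCivita I X Y p = leviCivita I X Y' p := by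
  unfold leviCivita
  exact Finset.sum_congr rfl fun i _ => congrArg (· • _)
    (koszulForm_congr (EventuallyEq.refl _ X) hY (EventuallyEq.refl _ _))

theorem leviCivita_congr_left (hX : DiffFieldAt I X p) (hX' : DiffFieldAt I X' p)
    (hY : DiffFieldAt I Y p) (h : X p = X' p) : leviCivita I X Y p = leviCivita I X' Y p :=
  inner_ext fun Z hZ => by
    rw [inner_leviCivita hX hY hZ.diffFieldAt, inner_leviCivita hX' hY hZ.diffFieldAt]
    exact (tensorialAt_koszulForm_left hY hZ.diffFieldAt).pointwise hX hX' h

theorem leviCivita_add_left (hX : DiffFieldAt I X p) (hX' : DiffFieldAt I X' p)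
    (hY : DiffFieldAt I Y p) :
    leviCivita I (X + X') Y p = leviCivita I X Y p + leviCivita I X' Y p :=
  inner_ext fun Z hZ => by
    rw [inner_add_left, inner_leviCivita hX hY hZ.diffFieldAt,
      inner_leviCivita hX' hY hZ.diffFieldAt, inner_leviCivita (hX.add hX') hY hZ.diffFieldAt]
    exact (tensorialAt_koszulForm_left hY hZ.diffFieldAt).add hX hX'

theorem leviCivita_add_right (hX : DiffFieldAt I X p) (hY : DiffFieldAt I Y p)
    (hY' : DiffFieldAt I Y' p) :
    leviCivita I X (Y + Y') p = leviCivita I X Y p + leviCivita I X Y' p :=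
  inner_ext fun Z hZ => by
    rw [inner_add_left, inner_leviCivita hX hY hZ.diffFieldAt,
      inner_leviCivita hX hY' hZ.diffFieldAt, inner_leviCivita hX (hY.add hY') hZ.diffFieldAt,
      koszulForm_add_middle hY hY' hX hZ.diffFieldAt]

theorem leviCivita_sub_right (hX : DiffFieldAt I X p) (hY : DiffFieldAt I Y p)
    (hY' : DiffFieldAt I Y' p) :
    leviCivita I X (Y - Y') p = leviCivita I X Y p - leviCivita I X Y' p := by
  rw [eq_sub_iff_add_eq, ← leviCivita_add_right hX (hY.sub hY') hY', sub_add_cancel]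

theorem leviCivita_metric (hX : DiffFieldAt I X p) (hY : DiffFieldAt I Y p)
    (hZ : DiffFieldAt I Z p) :
    mvfderiv I (fun q => inner ℝ (Y q) (Z q)) p (X p) =
      inner ℝ (leviCivita I X Y p) (Z p) + inner ℝ (Y p) (leviCivita I X Z p) := by
  rw [real_inner_comm _ (Y p), inner_leviCivita hX hY hZ, inner_leviCivita hX hZ hY,
    koszulForm_add_swap_right]

theorem leviCivita_torsion (hX : DiffFieldAt I X p) (hY : DiffFieldAt I Y p) :
    leviCivita I X Y p - leviCivita I Y X p = mlieBracket I X Y p :=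
  inner_ext fun Z hZ => by
    rw [inner_sub_left, inner_leviCivita hX hY hZ.diffFieldAt,
      inner_leviCivita hY hX hZ.diffFieldAt, koszulForm_sub_swap_left]

theorem contMDiffAt_koszulForm [Nontrivial E] (hX : SmoothFieldAt I X p) (hY : SmoothFieldAt I Y p)
    (hZ : SmoothFieldAt I Z p) : ContMDiffAt I 𝓘(ℝ) ∞ (koszulForm I X Y Z) p :=
  contMDiffAt_const.mul
    (((((hX.mvfderiv_apply (hY.inner hZ)).add (hY.mvfderiv_apply (hX.inner hZ))).sub
      (hZ.mvfderiv_apply (hX.inner hY))).add ((hX.mlieBracket hY).inner hZ)).sub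
      ((hX.mlieBracket hZ).inner hY) |>.sub ((hY.mlieBracket hZ).inner hX))

theorem SmoothFieldAt.gramSchmidt {m : ℕ} {s : Fin m → ∀ p : M, TangentSpace I p}
    (hs : ∀ i, SmoothFieldAt I (s i) p) (hli : LinearIndependent ℝ fun i => s i p) (i : Fin m) :
    SmoothFieldAt I (fun q => InnerProductSpace.gramSchmidt ℝ (fun i => s i q) i) p := by
  induction i using WellFoundedLT.induction with
  | ind i ih =>
  have : ∀ q, InnerProductSpace.gramSchmidt ℝ (fun i => s i q) i = s i q -
      ∑ j ∈ Finset.Iio i, (inner ℝ (InnerProductSpace.gramSchmidt ℝ (fun i => s i q) j) (s i q) /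
        inner ℝ (InnerProductSpace.gramSchmidt ℝ (fun i => s i q) j)
          (InnerProductSpace.gramSchmidt ℝ (fun i => s i q) j)) •
        InnerProductSpace.gramSchmidt ℝ (fun i => s i q) j := by
    intro q
    rw [eq_sub_iff_add_eq]
    conv_rhs => rw [InnerProductSpace.gramSchmidt_def'' ℝ (fun i => s i q) i]
    simp [real_inner_self_eq_norm_sq]
  simp only [this]
  refine (hs i).sub (ContMDiffAt.sum_section fun j hj => ?_)
  have hj' := ih j (Finset.mem_Iio.1 hj)
  refine SmoothFieldAt.smul ((hj'.inner (hs i)).div₀ (hj'.inner hj') ?_) hj'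
  simpa using InnerProductSpace.gramSchmidt_ne_zero j hli

theorem SmoothFieldAt.normalize (hX : SmoothFieldAt I X p) (h : X p ≠ 0) :
    SmoothFieldAt I (fun q => ‖X q‖⁻¹ • X q) p := by
  have h1 : inner ℝ (X p) (X p) ≠ (0 : ℝ) := by simpa using h
  have h2 : ContMDiffAt I 𝓘(ℝ) ∞ (fun q => Real.sqrt (inner ℝ (X q) (X q))) p :=
    (Real.contDiffAt_sqrt h1).contMDiffAt.comp p (hX.inner hX)
  have h3 := (h2.inv₀ (by simpa using h)).smul_section hX
  refine SmoothFieldAt.congr h3 (Eventually.of_forall fun q => ?_)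
  simp [real_inner_self_eq_norm_sq]

theorem exists_orthonormal_frame (p : M) :
    ∃ (m : ℕ) (e : Fin m → ∀ p : M, TangentSpace I p), (∀ i, SmoothFieldAt I (e i) p) ∧
      ∀ᶠ q in 𝓝 p, ∀ v : TangentSpace I q, v = ∑ i, inner ℝ v (e i q) • e i q := by
  let b := Module.finBasis ℝ E
  let t := trivializationAt E (fun p : M => TangentSpace I p) p
  have hp : p ∈ t.baseSet := FiberBundle.mem_baseSet_trivializationAt' p
  have hF := t.isLocalFrameOn_localFrame_baseSet I ∞ b
  have hs : ∀ i, SmoothFieldAt I (t.localFrame b i) p := fun i => hF.contMDiffAt t.open_baseSet hp i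
  have hg := SmoothFieldAt.gramSchmidt hs (hF.linearIndependent hp)
  refine ⟨_, fun i q => InnerProductSpace.gramSchmidtNormed ℝ (fun i => t.localFrame b i q) i,
    fun i => (hg i).normalize (InnerProductSpace.gramSchmidt_ne_zero i (hF.linearIndependent hp)),
    ?_⟩
  filter_upwards [t.open_baseSet.mem_nhds hp] with q hq v
  have : FiniteDimensional ℝ (TangentSpace I q) := inferInstanceAs (FiniteDimensional ℝ E)
  have hon := InnerProductSpace.gramSchmidtNormed_orthonormal (hF.linearIndependent hq) (𝕜 := ℝ)
  let B := OrthonormalBasis.mk hon (by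
    rw [InnerProductSpace.span_gramSchmidtNormed_range, InnerProductSpace.span_gramSchmidt]
    exact hF.generating hq)
  conv_lhs => rw [← B.sum_repr v]
  simp [B, OrthonormalBasis.repr_apply_apply, real_inner_comm]

protected theorem SmoothFieldAt.leviCivita [Nontrivial E] (hX : SmoothFieldAt I X p)
    (hY : SmoothFieldAt I Y p) : SmoothFieldAt I (leviCivita I X Y) p := by
  obtain ⟨m, e, he, hspan⟩ := exists_orthonormal_frame (I := I) p
  refine SmoothFieldAt.congr (ContMDiffAt.sum_section (t := fun i => koszulForm I X Y (e i) • e i)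
    (s := Finset.univ) fun i _ => (he i).smul (contMDiffAt_koszulForm hX hY (he i))) ?_
  filter_upwards [hspan, hX.eventually_diffFieldAt, hY.eventually_diffFieldAt,
    eventually_all.2 fun i => (he i).eventually_diffFieldAt] with q hq hXq hYq heq
  conv_lhs => rw [hq (leviCivita I X Y q)]
  simp [inner_leviCivita hXq hYq (heq _)]

end LeviCivita

/-- The algebraic identities of a curvature tensor. -/
structure IsCurvatureLike {V : Type*} [AddCommGroup V] [Module ℝ V] (R : V → V → V → V → ℝ) :
    Prop where
  add_right : ∀ x y z u v, R x y z (u + v) = R x y z u + R x y z v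
  smul_right : ∀ (c : ℝ) x y z u, R x y z (c • u) = c * R x y z u
  swap_left : ∀ x y z u, R x y z u = - R y x z u
  swap_right : ∀ x y z u, R x y z u = - R x y u z
  bianchi : ∀ x y z u, R x y z u + R y z x u + R z x y u = 0

section Curvature

set_option linter.unusedSectionVars false

variable {E : Type*} [NormedAddCommGroup E] [NormedSpace ℝ E] [FiniteDimensional ℝ E]
  {H : Type*} [TopologicalSpace H] {I : ModelWithCorners ℝ E H}
  {M : Type*} [TopologicalSpace M] [ChartedSpace H M] [IsManifold I ∞ M]
  [Bundle.RiemannianBundle (fun p : M => TangentSpace I p)]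
  [IsContMDiffRiemannianBundle I ∞ E (fun p : M => TangentSpace I p)]

open Filter Topology VectorField

variable {W X Y Z V X' Y' Z' V' : ∀ p : M, TangentSpace I p} {f : M → ℝ} {p : M}

theorem leviCivita_neg_left (hX : DiffFieldAt I X p) (hY : DiffFieldAt I Y p) :
    leviCivita I (-X) Y p = - leviCivita I X Y p :=
  inner_ext fun Z hZ => by
    have h := (tensorialAt_koszulForm_left hY hZ.diffFieldAt).smul
      (mdifferentiableAt_const (c := (-1 : ℝ))) hX
    have e : (-X) = (fun _ : M => (-1 : ℝ)) • X := by ext q; simp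
    have hX' : DiffFieldAt I (-X) p := by
      rw [e]; exact hX.smul mdifferentiableAt_const
    rw [inner_neg_left, inner_leviCivita hX hY hZ.diffFieldAt,
      inner_leviCivita hX' hY hZ.diffFieldAt, e, h]
    simp

variable [Nontrivial E]

theorem curvatureOperator_swap (hX : SmoothFieldAt I X p) (hY : SmoothFieldAt I Y p)
    (hZ : SmoothFieldAt I Z p) :
    curvatureOperator I X Y Z p = - curvatureOperator I Y X Z p := by
  unfold curvatureOperator
  rw [mlieBracket_swap (V := X) (W := Y),
    leviCivita_neg_left (hY.mlieBracket hX).diffFieldAt hZ.diffFieldAt]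
  abel

theorem curvatureOperator_bianchi (hX : SmoothFieldAt I X p) (hY : SmoothFieldAt I Y p)
    (hZ : SmoothFieldAt I Z p) :
    curvatureOperator I X Y Z p + curvatureOperator I Y Z X p + curvatureOperator I Z X Y p
      = 0 := by
  have key : ∀ {X Y Z : ∀ p : M, TangentSpace I p}, SmoothFieldAt I X p → SmoothFieldAt I Y p →
      SmoothFieldAt I Z p →
      leviCivita I X (leviCivita I Y Z) p - leviCivita I X (leviCivita I Z Y) p
        = mlieBracket I X (mlieBracket I Y Z) p + leviCivita I (mlieBracket I Y Z) X p := by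
    intro X Y Z hX hY hZ
    rw [← leviCivita_sub_right hX.diffFieldAt (hY.leviCivita hZ).diffFieldAt
      (hZ.leviCivita hY).diffFieldAt,
      ← leviCivita_torsion hX.diffFieldAt (hY.mlieBracket hZ).diffFieldAt, sub_add_cancel]
    refine leviCivita_congr_right ?_
    filter_upwards [hY.eventually_diffFieldAt, hZ.eventually_diffFieldAt] with q h1 h2
    rw [← leviCivita_torsion h1 h2]; rfl
  have h1 := key hX hY hZ
  have h2 := key hY hZ hX
  have h3 := key hZ hX hY
  have J := hX.jacobi hY hZ
  rw [mlieBracket_swap_apply (V := mlieBracket I X Y), mlieBracket_swap (V := X) (W := Z)] at J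
  have e : mlieBracket I Y (-mlieBracket I Z X) p = - mlieBracket I Y (mlieBracket I Z X) p := by
    have : (-mlieBracket I Z X) = (fun _ : M => (-1 : ℝ)) • mlieBracket I Z X := by ext q; simp
    rw [this, (hZ.mlieBracket hX).diffFieldAt.mlieBracket_smul_right mdifferentiableAt_const,
      mvfderiv_const]
    simp
  rw [e] at J
  unfold curvatureOperator
  calc _ = (leviCivita I X (leviCivita I Y Z) p - leviCivita I X (leviCivita I Z Y) p)
      + (leviCivita I Y (leviCivita I Z X) p - leviCivita I Y (leviCivita I X Z) p)
      + (leviCivita I Z (leviCivita I X Y) p - leviCivita I Z (leviCivita I Y X) p)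
      - leviCivita I (mlieBracket I Y Z) X p - leviCivita I (mlieBracket I Z X) Y p
      - leviCivita I (mlieBracket I X Y) Z p := by abel
    _ = 0 := by rw [h1, h2, h3, J]; abel

theorem inner_curvatureOperator_swap (hX : SmoothFieldAt I X p) (hY : SmoothFieldAt I Y p)
    (hZ : SmoothFieldAt I Z p) (hV : SmoothFieldAt I V p) :
    inner ℝ (curvatureOperator I X Y Z p) (V p) = - inner ℝ (curvatureOperator I X Y V p) (Z p) := by
  have key : ∀ {X Y : ∀ p : M, TangentSpace I p}, SmoothFieldAt I X p → SmoothFieldAt I Y p →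
      mvfderiv I (fun q => mvfderiv I (fun q => inner ℝ (Z q) (V q)) q (Y q)) p (X p) =
        inner ℝ (leviCivita I X (leviCivita I Y Z) p) (V p)
          + inner ℝ (leviCivita I Y Z p) (leviCivita I X V p)
          + (inner ℝ (leviCivita I X Z p) (leviCivita I Y V p)
          + inner ℝ (Z p) (leviCivita I X (leviCivita I Y V) p)) := by
    intro X Y hX hY
    rw [← leviCivita_metric hX.diffFieldAt (hY.leviCivita hZ).diffFieldAt hV.diffFieldAt,
      ← leviCivita_metric hX.diffFieldAt hZ.diffFieldAt (hY.leviCivita hV).diffFieldAt]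
    have e : (fun q => mvfderiv I (fun q => inner ℝ (Z q) (V q)) q (Y q)) =ᶠ[𝓝 p]
        (fun q => inner ℝ (leviCivita I Y Z q) (V q)) + fun q => inner ℝ (Z q) (leviCivita I Y V q) := by
      filter_upwards [hY.eventually_diffFieldAt, hZ.eventually_diffFieldAt,
        hV.eventually_diffFieldAt] with q h1 h2 h3
      exact leviCivita_metric h1 h2 h3
    rw [mvfderiv_congr e, mvfderiv_add ((hY.leviCivita hZ).diffFieldAt.inner hV.diffFieldAt)
      (hZ.diffFieldAt.inner (hY.leviCivita hV).diffFieldAt)]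
    rfl
  have h := mvfderiv_mlieBracket hX hY (hZ.inner hV)
  rw [key hX hY, key hY hX, leviCivita_metric (hX.mlieBracket hY).diffFieldAt hZ.diffFieldAt
    hV.diffFieldAt] at h
  unfold curvatureOperator
  simp only [inner_sub_left]
  simp only [real_inner_comm _ (Z p)] at h ⊢
  linarith

theorem inner_curvatureOperator_pair_symm (hX : SmoothFieldAt I X p) (hY : SmoothFieldAt I Y p)
    (hZ : SmoothFieldAt I Z p) (hV : SmoothFieldAt I V p) :
    inner ℝ (curvatureOperator I X Y Z p) (V p) = inner ℝ (curvatureOperator I Z V X p) (Y p) := by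
  have b : ∀ {X Y Z V : ∀ p : M, TangentSpace I p}, SmoothFieldAt I X p → SmoothFieldAt I Y p →
      SmoothFieldAt I Z p → inner ℝ (curvatureOperator I X Y Z p) (V p)
        + inner ℝ (curvatureOperator I Y Z X p) (V p)
        + inner ℝ (curvatureOperator I Z X Y p) (V p) = 0 := by
    intro X Y Z V hX hY hZ
    rw [← inner_add_left, ← inner_add_left, curvatureOperator_bianchi hX hY hZ, inner_zero_left]
  have s : ∀ {X Y Z V : ∀ p : M, TangentSpace I p}, SmoothFieldAt I X p → SmoothFieldAt I Y p →
      SmoothFieldAt I Z p → inner ℝ (curvatureOperator I X Y Z p) (V p)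
        = - inner ℝ (curvatureOperator I Y X Z p) (V p) := by
    intro X Y Z V hX hY hZ
    rw [← inner_neg_left, curvatureOperator_swap hX hY hZ]
  have b1 := b hX hY hZ (V := V)
  have b2 := b hY hZ hV (V := X)
  have b3 := b hZ hV hX (V := Y)
  have b4 := b hV hX hY (V := Z)
  have c1 := inner_curvatureOperator_swap hX hY hV hZ
  have c2 := inner_curvatureOperator_swap hY hZ hV hX
  have c3 := inner_curvatureOperator_swap hX hZ hV hY
  have c4 := s hX hZ hY (V := V)
  have c5 := inner_curvatureOperator_swap hZ hV hY hX
  have c6 := s hV hY hZ (V := X)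
  have c7 := inner_curvatureOperator_swap hY hV hZ hX
  have c8 := inner_curvatureOperator_swap hV hX hZ hY
  linarith

theorem curvatureOperator_congr_right (hX : SmoothFieldAt I X p) (hY : SmoothFieldAt I Y p)
    (hZ : SmoothFieldAt I Z p) (hZ' : SmoothFieldAt I Z' p) (h : Z p = Z' p) :
    curvatureOperator I X Y Z p = curvatureOperator I X Y Z' p :=
  inner_ext fun V hV => by
    rw [inner_curvatureOperator_swap hX hY hZ hV, inner_curvatureOperator_swap hX hY hZ' hV, h]

theorem curvatureOperator_congr (hX : SmoothFieldAt I X p) (hY : SmoothFieldAt I Y p)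
    (hZ : SmoothFieldAt I Z p) (hX' : SmoothFieldAt I X' p) (hY' : SmoothFieldAt I Y' p)
    (hZ' : SmoothFieldAt I Z' p) (h1 : X p = X' p) (h2 : Y p = Y' p) (h3 : Z p = Z' p) :
    curvatureOperator I X Y Z p = curvatureOperator I X' Y' Z' p :=
  inner_ext fun V hV => by
    rw [inner_curvatureOperator_pair_symm hX hY hZ hV,
      inner_curvatureOperator_pair_symm hX' hY' hZ' hV,
      curvatureOperator_congr_right hZ hV hX hX' h1, h2,
      ← inner_curvatureOperator_pair_symm hX' hY' hZ hV,
      ← inner_curvatureOperator_pair_symm hX' hY' hZ' hV,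
      curvatureOperator_congr_right hX' hY' hZ hZ' h3]

theorem inner_curvatureOperator (hX : SmoothFieldAt I X p) (hY : SmoothFieldAt I Y p)
    (hZ : SmoothFieldAt I Z p) (v : TangentSpace I p) :
    inner ℝ (curvatureOperator I X Y Z p) v = curvatureTensor I (X p) (Y p) (Z p) v := by
  unfold curvatureTensor
  rw [curvatureOperator_congr hX hY hZ (smoothFieldAt_extend (X p)) (smoothFieldAt_extend (Y p))
    (smoothFieldAt_extend (Z p))] <;> simp

theorem isCurvatureLike_curvatureTensor (p : M) :
    IsCurvatureLike fun x y z u : TangentSpace I p => curvatureTensor I x y z u where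
  add_right x y z u v := inner_add_right _ _ _
  smul_right c x y z u := real_inner_smul_right _ _ _
  swap_left x y z u := by
    simp only [curvatureTensor]
    rw [curvatureOperator_swap (smoothFieldAt_extend x) (smoothFieldAt_extend y)
      (smoothFieldAt_extend z), inner_neg_left]
  swap_right x y z u := by
    have := inner_curvatureOperator_swap (smoothFieldAt_extend x) (smoothFieldAt_extend y)
      (smoothFieldAt_extend z) (smoothFieldAt_extend u)
    rw [FiberBundle.extend_apply_self, FiberBundle.extend_apply_self] at this
    exact this
  bianchi x y z u := by
    simp only [curvatureTensor]
    rw [← inner_add_left, ← inner_add_left, curvatureOperator_bianchi (smoothFieldAt_extend x)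
      (smoothFieldAt_extend y) (smoothFieldAt_extend z), inner_zero_left]

protected theorem SmoothFieldAt.curvatureOperator (hX : SmoothFieldAt I X p)
    (hY : SmoothFieldAt I Y p) (hZ : SmoothFieldAt I Z p) :
    SmoothFieldAt I (curvatureOperator I X Y Z) p :=
  ((hX.leviCivita (hY.leviCivita hZ)).sub (hY.leviCivita (hX.leviCivita hZ))).sub
    ((hX.mlieBracket hY).leviCivita hZ)

theorem leviCivita_jacobi (hW : SmoothFieldAt I W p) (hX : SmoothFieldAt I X p)
    (hY : SmoothFieldAt I Y p) (hZ : SmoothFieldAt I Z p) :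
    leviCivita I (mlieBracket I W (mlieBracket I X Y)) Z p
      + leviCivita I (mlieBracket I X (mlieBracket I Y W)) Z p
      + leviCivita I (mlieBracket I Y (mlieBracket I W X)) Z p = 0 := by
  have h1 := hW.mlieBracket (hX.mlieBracket hY)
  have h2 := hX.mlieBracket (hY.mlieBracket hW)
  have h3 := hY.mlieBracket (hW.mlieBracket hX)
  have J := hW.jacobi hX hY
  have e : mlieBracket I X (mlieBracket I W Y) p = - mlieBracket I X (mlieBracket I Y W) p := by
    have : (mlieBracket I W Y) = (fun _ : M => (-1 : ℝ)) • mlieBracket I Y W := by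
      rw [mlieBracket_swap]; ext q; simp
    rw [this, (hY.mlieBracket hW).diffFieldAt.mlieBracket_smul_right mdifferentiableAt_const,
      mvfderiv_const]
    simp
  rw [mlieBracket_swap_apply (V := mlieBracket I W X), e] at J
  rw [← leviCivita_add_left h1.diffFieldAt h2.diffFieldAt hZ.diffFieldAt,
    ← leviCivita_add_left (h1.add h2).diffFieldAt h3.diffFieldAt hZ.diffFieldAt,
    leviCivita_congr_left (X' := (fun _ : M => (0 : ℝ)) • W) ((h1.add h2).add h3).diffFieldAt
      (hW.diffFieldAt.smul mdifferentiableAt_const) hZ.diffFieldAt]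
  · refine inner_ext fun V hV => ?_
    rw [inner_leviCivita (hW.diffFieldAt.smul mdifferentiableAt_const) hZ.diffFieldAt
      hV.diffFieldAt, inner_zero_left]
    have := (tensorialAt_koszulForm_left hZ.diffFieldAt hV.diffFieldAt).smul
      (mdifferentiableAt_const (c := (0 : ℝ))) hW.diffFieldAt
    rw [this, zero_smul]
  · simp [J]

theorem second_bianchi (hW : SmoothFieldAt I W p) (hX : SmoothFieldAt I X p)
    (hY : SmoothFieldAt I Y p) (hZ : SmoothFieldAt I Z p) :
    (leviCivita I W (curvatureOperator I X Y Z) p - curvatureOperator I X Y (leviCivita I W Z) p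
      + curvatureOperator I W (mlieBracket I X Y) Z p)
    + (leviCivita I X (curvatureOperator I Y W Z) p - curvatureOperator I Y W (leviCivita I X Z) p
      + curvatureOperator I X (mlieBracket I Y W) Z p)
    + (leviCivita I Y (curvatureOperator I W X Z) p - curvatureOperator I W X (leviCivita I Y Z) p
      + curvatureOperator I Y (mlieBracket I W X) Z p) = 0 := by
  have key : ∀ {W X Y : ∀ p : M, TangentSpace I p}, SmoothFieldAt I W p → SmoothFieldAt I X p →
      SmoothFieldAt I Y p → leviCivita I W (curvatureOperator I X Y Z) p =
        leviCivita I W (leviCivita I X (leviCivita I Y Z)) p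
        - leviCivita I W (leviCivita I Y (leviCivita I X Z)) p
        - leviCivita I W (leviCivita I (mlieBracket I X Y) Z) p := by
    intro W X Y hW hX hY
    have h1 := hX.leviCivita (hY.leviCivita hZ)
    have h2 := hY.leviCivita (hX.leviCivita hZ)
    have h3 := (hX.mlieBracket hY).leviCivita hZ
    rw [← leviCivita_sub_right hW.diffFieldAt h1.diffFieldAt h2.diffFieldAt,
      ← leviCivita_sub_right hW.diffFieldAt (h1.sub h2).diffFieldAt h3.diffFieldAt]
    rfl
  rw [key hW hX hY, key hX hY hW, key hY hW hX]
  unfold curvatureOperator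
  rw [← neg_eq_zero, ← leviCivita_jacobi hW hX hY hZ]
  abel

end Curvature

namespace IsCurvatureLike

variable {V : Type*} [AddCommGroup V] [Module ℝ V] {R : V → V → V → V → ℝ}

theorem pair_symm (h : IsCurvatureLike R) (x y z u : V) : R x y z u = R z u x y := by
  have b1 := h.bianchi x y z u
  have b2 := h.bianchi y z u x
  have b3 := h.bianchi z u x y
  have b4 := h.bianchi u x y z
  have c1 := h.swap_right x y u z
  have c2 := h.swap_right y z u x
  have c3 := h.swap_right x z u y
  have c4 := h.swap_left x z y u
  have c5 := h.swap_right z u y x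
  have c6 := h.swap_left u y z x
  have c7 := h.swap_right y u z x
  have c8 := h.swap_right u x z y
  linarith

theorem add_third (h : IsCurvatureLike R) (x y z z' u : V) :
    R x y (z + z') u = R x y z u + R x y z' u := by
  rw [h.swap_right, h.add_right, h.swap_right x y z, h.swap_right x y z']; ring

theorem add_first (h : IsCurvatureLike R) (x x' y z u : V) :
    R (x + x') y z u = R x y z u + R x' y z u := by
  rw [h.pair_symm, h.add_third, h.pair_symm x, h.pair_symm x']

theorem add_second (h : IsCurvatureLike R) (x y y' z u : V) :
    R x (y + y') z u = R x y z u + R x y' z u := by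
  rw [h.pair_symm, h.add_right, h.pair_symm x, h.pair_symm x]

theorem smul_third (h : IsCurvatureLike R) (c : ℝ) (x y z u : V) :
    R x y (c • z) u = c * R x y z u := by
  rw [h.swap_right, h.smul_right, h.swap_right x y z]; ring

theorem smul_first (h : IsCurvatureLike R) (c : ℝ) (x y z u : V) :
    R (c • x) y z u = c * R x y z u := by
  rw [h.pair_symm, h.smul_third, h.pair_symm x]

theorem smul_second (h : IsCurvatureLike R) (c : ℝ) (x y z u : V) :
    R x (c • y) z u = c * R x y z u := by
  rw [h.pair_symm, h.smul_right, h.pair_symm x]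

theorem self_right (h : IsCurvatureLike R) (x y z : V) : R x y z z = 0 := by
  linarith [h.swap_right x y z z]

/-- If `R(a,b,c,d)` vanishes whenever two of the first three arguments agree, up to sign changes
under exchange of the middle arguments, it vanishes. -/
theorem eq_zero_of_alternating (h : IsCurvatureLike R) {a b c d : V}
    (h1 : R a b c d + R a c b d = 0) (h2 : R b c a d + R b a c d = 0) : R a b c d = 0 := by
  linarith [h.bianchi a b c d, h.swap_left a b c d, h.swap_left c a b d]

end IsCurvatureLike

section HermitianAlgebra

variable {V : Type*} [NormedAddCommGroup V] [InnerProductSpace ℝ V] {J : V →ₗ[ℝ] V}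

/-- Orthogonality with respect to the Hermitian form of the complex structure `J`. -/
def HermitianOrthogonal (J : V →ₗ[ℝ] V) (x y : V) : Prop :=
  inner ℝ x y = 0 ∧ inner ℝ (J x) y = 0

/-- A linear orthogonal complex structure. -/
structure IsOrthogonalComplexStructure (J : V →ₗ[ℝ] V) : Prop where
  sq : ∀ x, J (J x) = -x
  orthogonal : ∀ x y, inner ℝ (J x) (J y) = inner ℝ x y

namespace IsOrthogonalComplexStructure

variable (hJ : IsOrthogonalComplexStructure J)
include hJ

theorem inner_right (x y : V) : inner ℝ x (J y) = - inner ℝ (J x) y := by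
  rw [← hJ.orthogonal x, hJ.sq, inner_neg_right]

theorem inner_self (x : V) : inner ℝ (J x) x = 0 := by
  have h := hJ.inner_right x x
  rw [real_inner_comm] at h
  linarith

theorem inner_self' (x : V) : inner ℝ x (J x) = 0 := by
  rw [real_inner_comm, hJ.inner_self]

theorem symm {x y : V} (h : HermitianOrthogonal J x y) : HermitianOrthogonal J y x :=
  ⟨by rw [real_inner_comm]; exact h.1, by rw [real_inner_comm, hJ.inner_right, h.2, neg_zero]⟩

theorem apply_left {x y : V} (h : HermitianOrthogonal J x y) : HermitianOrthogonal J (J x) y :=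
  ⟨h.2, by rw [hJ.sq, inner_neg_left, h.1, neg_zero]⟩

end IsOrthogonalComplexStructure

namespace HermitianOrthogonal

theorem add_left {x x' y : V} (h : HermitianOrthogonal J x y) (h' : HermitianOrthogonal J x' y) :
    HermitianOrthogonal J (x + x') y :=
  ⟨by rw [inner_add_left, h.1, h'.1, add_zero], by rw [map_add, inner_add_left, h.2, h'.2, add_zero]⟩

theorem smul_left {x y : V} (c : ℝ) (h : HermitianOrthogonal J x y) :
    HermitianOrthogonal J (c • x) y :=
  ⟨by rw [real_inner_smul_left, h.1, mul_zero],
    by rw [map_smul, real_inner_smul_left, h.2, mul_zero]⟩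

theorem add_right {x y y' : V} (h : HermitianOrthogonal J x y) (h' : HermitianOrthogonal J x y') :
    HermitianOrthogonal J x (y + y') :=
  ⟨by rw [inner_add_right, h.1, h'.1, add_zero], by rw [inner_add_right, h.2, h'.2, add_zero]⟩

theorem smul_right {x y : V} (c : ℝ) (h : HermitianOrthogonal J x y) :
    HermitianOrthogonal J x (c • y) :=
  ⟨by rw [real_inner_smul_right, h.1, mul_zero], by rw [real_inner_smul_right, h.2, mul_zero]⟩

end HermitianOrthogonal

/-- The curvature-like tensor `R` vanishes on all antiholomorphic planes. -/
def VanishesOnAntiholomorphic (J : V →ₗ[ℝ] V) (R : V → V → V → V → ℝ) : Prop :=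
  ∀ x y, HermitianOrthogonal J x y → R x y y x = 0

theorem VanishesOnAntiholomorphic.of_unit
    {R : V → V → V → V → ℝ} (hR : IsCurvatureLike R)
    (h : ∀ x y, ‖x‖ = 1 → ‖y‖ = 1 → HermitianOrthogonal J x y → R x y y x = 0) :
    VanishesOnAntiholomorphic J R := by
  intro x y hxy
  by_cases hx : x = 0
  · simpa [hx] using hR.smul_first 0 x y y x
  by_cases hy : y = 0
  · simpa [hy] using hR.smul_second 0 x y y x
  have key := h _ _ (norm_smul_inv_norm (𝕜 := ℝ) hx) (norm_smul_inv_norm (𝕜 := ℝ) hy)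
    ((hxy.smul_right _).smul_left _)
  rw [hR.smul_first, hR.smul_second, hR.smul_third, hR.smul_right] at key
  simpa [hx, hy] using key

variable {R : V → V → V → V → ℝ} (hJ : IsOrthogonalComplexStructure J) (hR : IsCurvatureLike R)
  (h0 : VanishesOnAntiholomorphic J R)

include hR h0 in
theorem VanishesOnAntiholomorphic.diag {a b d : V} (hab : HermitianOrthogonal J a b)
    (hdb : HermitianOrthogonal J d b) : R a b b d = 0 := by
  have h1 := h0 (a + d) b (hab.add_left hdb)
  rw [hR.add_first, hR.add_right, hR.add_right, h0 a b hab, h0 d b hdb] at h1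
  linarith [hR.pair_symm d b b a, hR.swap_left b a d b, hR.swap_right a b d b]

include hR h0 in
theorem VanishesOnAntiholomorphic.polar {a b c d : V} (hab : HermitianOrthogonal J a b)
    (hac : HermitianOrthogonal J a c) (hdb : HermitianOrthogonal J d b)
    (hdc : HermitianOrthogonal J d c) : R a b c d + R a c b d = 0 := by
  have h1 := h0.diag hR (hab.add_right hac) (hdb.add_right hdc)
  rw [hR.add_second, hR.add_third, hR.add_third, h0.diag hR hab hdb, h0.diag hR hac hdc] at h1
  linarith

include hJ hR h0 in
theorem VanishesOnAntiholomorphic.rotate {a b c : V} (hab : HermitianOrthogonal J a b)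
    (hac : HermitianOrthogonal J a c) (hbc : HermitianOrthogonal J b c) (hn : ‖b‖ = ‖c‖) :
    R a b c (J c) + R a c b (J c) = R a b b (J b) ∧
      R a b c (J b) + R a c b (J b) = R a c c (J c) := by
  have key : ∀ t : ℝ, t ^ 2 = 1 → R a (b + t • c) (b + t • c) (J c + (-t) • J b) = 0 := by
    intro t ht
    refine h0.diag hR (hab.add_right (hac.smul_right t)) ?_
    have hcb := hJ.symm hbc
    have e1 : inner ℝ b b = inner ℝ c c := by
      rw [real_inner_self_eq_norm_sq, real_inner_self_eq_norm_sq, hn]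
    constructor
    · simp only [inner_add_left, inner_add_right, real_inner_smul_left, real_inner_smul_right,
        hcb.2, hbc.2, hJ.inner_self]
      ring
    · simp only [inner_add_left, inner_add_right, real_inner_smul_left, real_inner_smul_right,
        map_add, map_smul, hJ.sq, inner_neg_left, hcb.1, hbc.1, e1]
      ring
  have k1 := key 1 (by norm_num)
  have k2 := key (-1) (by norm_num)
  have z1 : R a b b (J c) = 0 := h0.diag hR hab (hJ.apply_left (hJ.symm hbc))
  have z2 : R a c c (J b) = 0 := h0.diag hR hac (hJ.apply_left hbc)
  simp only [hR.add_second, hR.add_third, hR.add_right, hR.smul_second, hR.smul_third,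
    hR.smul_right, z1, z2] at k1 k2
  constructor <;> linarith

include hJ hR h0 in
theorem VanishesOnAntiholomorphic.two_mul_eq {a b c : V} (hab : HermitianOrthogonal J a b)
    (hac : HermitianOrthogonal J a c) (hbc : HermitianOrthogonal J b c) (hn : ‖b‖ = ‖c‖) :
    2 * R a b b (J b) = 3 * R a b c (J c) := by
  have h1 := (h0.rotate hJ hR hab hac hbc hn).1
  have h2 := h0.polar hR (hJ.symm hac) (hJ.symm hbc) (hJ.apply_left (hJ.symm hac))
    (hJ.apply_left (hJ.symm hbc))
  have h3 := hR.bianchi a b c (J c)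
  have h4 := hR.swap_left b c a (J c)
  have h5 := hR.swap_left c a b (J c)
  linarith

include hJ hR h0 in
theorem VanishesOnAntiholomorphic.eq_zero_of_diag {a b : V} (hab : HermitianOrthogonal J a b)
    (hb : ‖b‖ = 1) (h : R a b b (J b) = 0) (d : V) : R a b b d = 0 := by
  have hbb : inner ℝ b b = (1 : ℝ) := by rw [real_inner_self_eq_norm_sq, hb]; norm_num
  have hd : d = inner ℝ b d • b + inner ℝ (J b) d • J b
      + (d + ((-inner ℝ b d) • b + (-inner ℝ (J b) d) • J b)) := by module
  rw [hd, hR.add_right, hR.add_right, hR.smul_right, hR.smul_right, hR.self_right, h,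
    h0.diag hR hab (hJ.symm ⟨?_, ?_⟩)]
  · ring
  · simp only [inner_add_right, real_inner_smul_right, hJ.inner_self', hbb]; ring
  · simp only [inner_add_right, real_inner_smul_right, hJ.inner_self, hJ.orthogonal, hbb]; ring

include hJ hR h0 in
theorem VanishesOnAntiholomorphic.polar_eq_zero {a b c : V} (hab : HermitianOrthogonal J a b)
    (hac : HermitianOrthogonal J a c) (hbc : HermitianOrthogonal J b c) (hb : ‖b‖ = 1)
    (hc : ‖c‖ = 1) (h1 : R a b b (J b) = 0) (h2 : R a c c (J c) = 0) (d : V) :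
    R a b c d + R a c b d = 0 := by
  have hbb : inner ℝ b b = (1 : ℝ) := by rw [real_inner_self_eq_norm_sq, hb]; norm_num
  have hcc : inner ℝ c c = (1 : ℝ) := by rw [real_inner_self_eq_norm_sq, hc]; norm_num
  have hcb := hJ.symm hbc
  have hr := h0.rotate hJ hR hab hac hbc (hb.trans hc.symm)
  have e1 : R a b c b = 0 := by
    rw [hR.swap_right, h0.eq_zero_of_diag hJ hR hab hb h1, neg_zero]
  have e2 : R a c b c = 0 := by
    rw [hR.swap_right, h0.eq_zero_of_diag hJ hR hac hc h2, neg_zero]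
  have f1 : inner ℝ b (J c) = 0 := by rw [hJ.inner_right, hbc.2, neg_zero]
  have f2 : inner ℝ c (J b) = 0 := by rw [hJ.inner_right, hcb.2, neg_zero]
  set d' := d + ((-inner ℝ b d) • b + (-inner ℝ (J b) d) • J b
    + ((-inner ℝ c d) • c + (-inner ℝ (J c) d) • J c)) with hd'
  have hd : d = inner ℝ b d • b + inner ℝ (J b) d • J b
      + (inner ℝ c d • c + inner ℝ (J c) d • J c) + d' := by rw [hd']; module
  have p1 : HermitianOrthogonal J b d' := by
    constructor
    · simp only [hd', inner_add_right, real_inner_smul_right, hJ.inner_self', hbb, hbc.1, f1]; ring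
    · simp only [hd', inner_add_right, real_inner_smul_right, hJ.inner_self, hJ.orthogonal, hbb,
        hbc.1, hbc.2]
      ring
  have p2 : HermitianOrthogonal J c d' := by
    constructor
    · simp only [hd', inner_add_right, real_inner_smul_right, hJ.inner_self', hcc, hcb.1, f2]; ring
    · simp only [hd', inner_add_right, real_inner_smul_right, hJ.inner_self, hJ.orthogonal, hcc,
        hcb.1, hcb.2]
      ring
  have hp := h0.polar hR hab hac (hJ.symm p1) (hJ.symm p2)
  rw [hd]
  simp only [hR.add_right, hR.smul_right, hR.self_right, e1, e2]
  rw [h1, h2] at hr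
  linear_combination hp + inner ℝ (J c) d * hr.1 + inner ℝ (J b) d * hr.2

include hJ hR h0 in
/-- A criterion for a curvature-like tensor that vanishes on the antiholomorphic planes to vanish
on a totally real triple. -/
theorem VanishesOnAntiholomorphic.eq_zero_of_triple {a b c : V} (hab : HermitianOrthogonal J a b)
    (hac : HermitianOrthogonal J a c) (hbc : HermitianOrthogonal J b c) (ha : ‖a‖ = 1)
    (hb : ‖b‖ = 1) (hc : ‖c‖ = 1) (h1 : R a b a (J a) = 0) (h2 : R a c a (J a) = 0)
    (h3 : R b c a (J a) = 0) (d : V) :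
    R a b b d = 0 ∧ R b a a d = 0 ∧ R a c c d = 0 ∧ R c a a d = 0 ∧ R b c c d = 0 ∧ R c b b d = 0 ∧
      R a b c d = 0 ∧ R b c a d = 0 ∧ R c a b d = 0 := by
  have hba := hJ.symm hab
  have hca := hJ.symm hac
  have hcb := hJ.symm hbc
  have nbc : ‖b‖ = ‖c‖ := hb.trans hc.symm
  have nab : ‖a‖ = ‖b‖ := ha.trans hb.symm
  have nac : ‖a‖ = ‖c‖ := ha.trans hc.symm
  have t1 := h0.two_mul_eq hJ hR hab hac hbc nbc
  have t2 := h0.two_mul_eq hJ hR hba hbc hac nac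
  have t3 := h0.two_mul_eq hJ hR hac hab hcb nbc.symm
  have t4 := h0.two_mul_eq hJ hR hca hcb hab nab
  have t5 := h0.two_mul_eq hJ hR hbc hba hca nac.symm
  have t6 := h0.two_mul_eq hJ hR hcb hca hba nab.symm
  have s1 := hR.swap_left b a
  have s2 := hR.swap_left c a
  have s3 := hR.swap_left c b
  have z2 : R b a a (J a) = 0 := by rw [s1, h1, neg_zero]
  have z4 : R c a a (J a) = 0 := by rw [s2, h2, neg_zero]
  have z1 : R a b b (J b) = 0 := by linarith [s1 c (J c)]
  have z3 : R a c c (J c) = 0 := by linarith [s2 b (J b)]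
  have z5 : R b c c (J c) = 0 := by linarith
  have z6 : R c b b (J b) = 0 := by linarith [s3 a (J a)]
  have q1 := h0.polar_eq_zero hJ hR hab hac hbc hb hc z1 z3 d
  have q2 := h0.polar_eq_zero hJ hR hba hbc hac ha hc z2 z5 d
  have q3 := h0.polar_eq_zero hJ hR hca hcb hab ha hb z4 z6 d
  exact ⟨h0.eq_zero_of_diag hJ hR hab hb z1 d, h0.eq_zero_of_diag hJ hR hba ha z2 d,
    h0.eq_zero_of_diag hJ hR hac hc z3 d, h0.eq_zero_of_diag hJ hR hca ha z4 d,
    h0.eq_zero_of_diag hJ hR hbc hc z5 d, h0.eq_zero_of_diag hJ hR hcb hb z6 d,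
    hR.eq_zero_of_alternating q1 (by linarith), hR.eq_zero_of_alternating (by linarith) (by linarith),
    hR.eq_zero_of_alternating q3 q1⟩

theorem exists_unit_orthogonal {m : ℕ} (h : m < Module.finrank ℝ V) (s : Fin m → V) :
    ∃ v : V, ‖v‖ = 1 ∧ ∀ i, inner ℝ (s i) v = 0 := by
  have : FiniteDimensional ℝ V := Module.finite_of_finrank_pos (by omega)
  have h1 : Module.finrank ℝ (Submodule.span ℝ (Set.range s)) ≤ m :=
    (finrank_range_le_card (R := ℝ) s).trans (by simp)
  have h2 : (Submodule.span ℝ (Set.range s))ᗮ ≠ ⊥ := by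
    intro h3
    have := Submodule.finrank_add_finrank_orthogonal (Submodule.span ℝ (Set.range s))
    rw [h3, finrank_bot] at this
    omega
  obtain ⟨v, hv, hv0⟩ := Submodule.exists_mem_ne_zero_of_ne_bot h2
  refine ⟨‖v‖⁻¹ • v, norm_smul_inv_norm hv0, fun i => ?_⟩
  rw [real_inner_smul_right, (Submodule.mem_orthogonal _ _).1 hv _
    (Submodule.subset_span ⟨i, rfl⟩), mul_zero]

include hJ in
theorem exists_isotropic_pair (hV : 6 ≤ Module.finrank ℝ V) {w : V}
    (f : V →ₗ[ℝ] ℝ) (h : V →ₗ[ℝ] V →ₗ[ℝ] ℝ) :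
    ∃ x y : V, ‖x‖ = 1 ∧ ‖y‖ = 1 ∧ HermitianOrthogonal J w x ∧ HermitianOrthogonal J w y ∧
      HermitianOrthogonal J x y ∧ f x = 0 ∧ f y = 0 ∧ h x y = 0 := by
  have : FiniteDimensional ℝ V := Module.finite_of_finrank_pos (by omega)
  obtain ⟨F, hF⟩ : ∃ F : V, ∀ v, f v = inner ℝ F v :=
    ⟨(InnerProductSpace.toDual ℝ V).symm (LinearMap.toContinuousLinearMap f), fun v => by
      rw [InnerProductSpace.toDual_symm_apply]; rfl⟩
  obtain ⟨y, hy, hyo⟩ := exists_unit_orthogonal (by omega) ![w, J w, F, J F]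
  simp only [Fin.forall_fin_succ, Matrix.cons_val_zero, Matrix.cons_val_succ] at hyo
  obtain ⟨x, hx, hxo⟩ := exists_unit_orthogonal (by omega) ![w, J w, y, J y, F]
  simp only [Fin.forall_fin_succ, Matrix.cons_val_zero, Matrix.cons_val_succ] at hxo
  have hwx : HermitianOrthogonal J w x := ⟨hxo.1, hxo.2.1⟩
  have hwy : HermitianOrthogonal J w y := ⟨hyo.1, hyo.2.1⟩
  have hyx : HermitianOrthogonal J y x := ⟨hxo.2.2.1, hxo.2.2.2.1⟩
  have hfx : f x = 0 := by rw [hF]; exact hxo.2.2.2.2.1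
  have hfy : f y = 0 := by rw [hF]; exact hyo.2.2.1
  have hfJy : f (J y) = 0 := by rw [hF, hJ.inner_right, hyo.2.2.2.1, neg_zero]
  obtain ⟨α, β, hαβ, h0⟩ : ∃ α β : ℝ, α ^ 2 + β ^ 2 = 1 ∧ α * h x y + β * h x (J y) = 0 := by
    by_cases hz : h x y = 0 ∧ h x (J y) = 0
    · exact ⟨1, 0, by norm_num, by rw [hz.1, hz.2]; ring⟩
    · have hpos : 0 < h x y ^ 2 + h x (J y) ^ 2 := by
        by_contra hn
        exact hz ⟨by nlinarith [sq_nonneg (h x y), sq_nonneg (h x (J y))],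
          by nlinarith [sq_nonneg (h x y), sq_nonneg (h x (J y))]⟩
      have hs := Real.sq_sqrt hpos.le
      have hs0 := (Real.sqrt_pos.2 hpos).ne'
      refine ⟨h x (J y) / Real.sqrt (h x y ^ 2 + h x (J y) ^ 2),
        - h x y / Real.sqrt (h x y ^ 2 + h x (J y) ^ 2), ?_, by ring⟩
      rw [div_pow, div_pow, hs, ← add_div, div_eq_one_iff_eq hpos.ne']
      ring
  have hJy := hJ.apply_left hyx
  refine ⟨x, α • y + β • J y, hx, ?_, hwx, (hwy.smul_right α).add_right
    (HermitianOrthogonal.smul_right β (hJ.symm (hJ.apply_left (hJ.symm hwy)))),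
    hJ.symm ((hyx.smul_left α).add_left (hJy.smul_left β)), hfx, ?_, ?_⟩
  · have : ‖α • y + β • J y‖ ^ 2 = 1 := by
      have hyy : inner ℝ y y = (1 : ℝ) := by rw [real_inner_self_eq_norm_sq, hy]; norm_num
      rw [← real_inner_self_eq_norm_sq]
      simp only [inner_add_left, inner_add_right, real_inner_smul_left, real_inner_smul_right,
        hJ.inner_self, hJ.inner_self', hJ.orthogonal, hyy]
      linear_combination hαβ
    nlinarith [norm_nonneg (α • y + β • J y)]
  · simp [hfy, hfJy]
  · simpa using h0

end HermitianAlgebra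

section HermitianProjection

variable {V : Type*} [NormedAddCommGroup V] [InnerProductSpace ℝ V] {J : V →ₗ[ℝ] V}

/-- The component of `b` Hermitian-orthogonal to the unit vector `a`. -/
def hermitianProj (J : V →ₗ[ℝ] V) (a b : V) : V :=
  b - (inner ℝ a b • a + inner ℝ (J a) b • J a)

theorem IsOrthogonalComplexStructure.hermitianOrthogonal_proj
    (hJ : IsOrthogonalComplexStructure J) {a : V} (ha : ‖a‖ = 1) (b : V) :
    HermitianOrthogonal J a (hermitianProj J a b) := by
  have haa : inner ℝ a a = (1 : ℝ) := by rw [real_inner_self_eq_norm_sq, ha]; norm_num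
  constructor
  · simp only [hermitianProj, inner_sub_right, inner_add_right, real_inner_smul_right, haa,
      hJ.inner_self']
    ring
  · simp only [hermitianProj, inner_sub_right, inner_add_right, real_inner_smul_right, haa,
      hJ.inner_self, hJ.orthogonal]
    ring

theorem HermitianOrthogonal.proj_right (hJ : IsOrthogonalComplexStructure J) {a b c : V}
    (h1 : HermitianOrthogonal J c a) (h2 : HermitianOrthogonal J c b) :
    HermitianOrthogonal J c (hermitianProj J a b) := by
  have h3 := hJ.symm (hJ.apply_left (hJ.symm h1))
  have e : hermitianProj J a b
      = b + ((-inner ℝ a b) • a + (-inner ℝ (J a) b) • J a) := by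
    unfold hermitianProj; module
  rw [e]
  exact h2.add_right ((h1.smul_right _).add_right (h3.smul_right _))

theorem HermitianOrthogonal.proj_eq {a b : V} (h : HermitianOrthogonal J a b) :
    hermitianProj J a b = b := by
  simp [hermitianProj, h.1, h.2]

/-- The curvature tensor of constant curvature one. -/
def constantCurvatureTensor (x y z u : V) : ℝ :=
  inner ℝ x u * inner ℝ y z - inner ℝ x z * inner ℝ y u

theorem IsCurvatureLike.sub_constant {R : V → V → V → V → ℝ} (hR : IsCurvatureLike R) (k : ℝ) :
    IsCurvatureLike fun x y z u => R x y z u - k * constantCurvatureTensor x y z u where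
  add_right x y z u v := by
    simp only [hR.add_right, constantCurvatureTensor, inner_add_right]; ring
  smul_right c x y z u := by
    simp only [hR.smul_right, constantCurvatureTensor, real_inner_smul_right]; ring
  swap_left x y z u := by
    rw [hR.swap_left]; simp only [constantCurvatureTensor]; ring
  swap_right x y z u := by
    rw [hR.swap_right]; simp only [constantCurvatureTensor]; ring
  bianchi x y z u := by
    have := hR.bianchi x y z u
    simp only [constantCurvatureTensor, real_inner_comm z x, real_inner_comm y x,
      real_inner_comm z y]
    linarith

end HermitianProjection

section AntiholomorphicCurvature

set_option linter.unusedSectionVars false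

variable {E : Type*} [NormedAddCommGroup E] [NormedSpace ℝ E] [FiniteDimensional ℝ E]
  {H : Type*} [TopologicalSpace H] {I : ModelWithCorners ℝ E H}
  {M : Type*} [TopologicalSpace M] [ChartedSpace H M] [IsManifold I ∞ M]
  [Bundle.RiemannianBundle (fun p : M => TangentSpace I p)]
  [IsContMDiffRiemannianBundle I ∞ E (fun p : M => TangentSpace I p)]
  {J : ∀ p : M, TangentSpace I p →L[ℝ] TangentSpace I p} {ν : M → ℝ}

open Filter Topology VectorField

theorem IsAlmostHermitian.isOrthogonalComplexStructure (hJ : IsAlmostHermitian I J) (p : M) :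
    IsOrthogonalComplexStructure (J p : TangentSpace I p →ₗ[ℝ] TangentSpace I p) :=
  ⟨hJ.sq p, hJ.orthogonal p⟩

theorem SmoothFieldAt.almostComplex {X : ∀ p : M, TangentSpace I p} {p : M}
    (hJ : IsAlmostHermitian I J) (hX : SmoothFieldAt I X p) :
    SmoothFieldAt I (fun q => J q (X q)) p :=
  ContMDiffAt.clm_bundle_apply (hJ.smooth p) hX

theorem HasPointwiseConstantAntiholomorphicCurvature.curvatureTensor_eq
    (hJ : IsAlmostHermitian I J) (hν : HasPointwiseConstantAntiholomorphicCurvature I J ν) {p : M}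
    {x y : TangentSpace I p} (hx : ‖x‖ = 1) (hy : ‖y‖ = 1)
    (hxy : HermitianOrthogonal (J p : TangentSpace I p →ₗ[ℝ] TangentSpace I p) x y) :
    curvatureTensor I x y y x = ν p := by
  have hJp := hJ.isOrthogonalComplexStructure p
  have hon : Orthonormal ℝ ![x, y] := by
    simp [orthonormal_vecCons_iff, hx, hy, hxy.1]
  have hr : Set.range ![x, y] = {x, y} := by simp [Set.pair_comm]
  have hfin : Module.finrank ℝ (Submodule.span ℝ {x, y}) = 2 := by
    rw [← hr]
    simpa using finrank_span_eq_card hon.linearIndependent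
  refine (hν p (Submodule.span ℝ {x, y}) ⟨hfin, fun a ha b hb => ?_⟩).2 x y hon rfl
  obtain ⟨a1, a2, rfl⟩ := Submodule.mem_span_pair.1 ha
  obtain ⟨b1, b2, rfl⟩ := Submodule.mem_span_pair.1 hb
  have h1 := hJp.inner_self x
  have h2 := hJp.inner_self y
  have h3 := hxy.2
  have h4 := (hJp.symm hxy).2
  simp only [ContinuousLinearMap.coe_coe] at h1 h2 h3 h4
  simp [inner_add_left, inner_add_right, real_inner_smul_left, real_inner_smul_right, h1, h2, h3,
    h4]

theorem HasPointwiseConstantAntiholomorphicCurvature.vanishes [Nontrivial E]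
    (hJ : IsAlmostHermitian I J) (hν : HasPointwiseConstantAntiholomorphicCurvature I J ν) (p : M) :
    VanishesOnAntiholomorphic (J p : TangentSpace I p →ₗ[ℝ] TangentSpace I p)
      fun x y z u : TangentSpace I p =>
        curvatureTensor I x y z u - ν p * constantCurvatureTensor x y z u := by
  have hR := (isCurvatureLike_curvatureTensor (I := I) p).sub_constant (ν p)
  have hJp := hJ.isOrthogonalComplexStructure p
  have unit : ∀ x y : TangentSpace I p, ‖x‖ = 1 → ‖y‖ = 1 →
      HermitianOrthogonal (J p : TangentSpace I p →ₗ[ℝ] TangentSpace I p) x y →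
      curvatureTensor I x y y x - ν p * constantCurvatureTensor x y y x = 0 := by
    intro x y hx hy hxy
    rw [hν.curvatureTensor_eq hJ hx hy hxy]
    simp [constantCurvatureTensor, hx, hy, hxy.1]
  exact VanishesOnAntiholomorphic.of_unit hR unit

theorem exists_adapted_fields (hJ : IsAlmostHermitian I J) {p : M} {w x y : TangentSpace I p}
    (hw : ‖w‖ = 1) (hx : ‖x‖ = 1) (hy : ‖y‖ = 1)
    (hwx : HermitianOrthogonal (J p : TangentSpace I p →ₗ[ℝ] TangentSpace I p) w x)
    (hwy : HermitianOrthogonal (J p : TangentSpace I p →ₗ[ℝ] TangentSpace I p) w y)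
    (hxy : HermitianOrthogonal (J p : TangentSpace I p →ₗ[ℝ] TangentSpace I p) x y) :
    ∃ W X Y : ∀ p : M, TangentSpace I p, W p = w ∧ X p = x ∧ Y p = y ∧
      ∀ᶠ q in 𝓝 p, SmoothFieldAt I W q ∧ SmoothFieldAt I X q ∧ SmoothFieldAt I Y q ∧
        ‖W q‖ = 1 ∧ ‖X q‖ = 1 ∧ ‖Y q‖ = 1 ∧
        HermitianOrthogonal (J q : TangentSpace I q →ₗ[ℝ] TangentSpace I q) (W q) (X q) ∧
        HermitianOrthogonal (J q : TangentSpace I q →ₗ[ℝ] TangentSpace I q) (W q) (Y q) ∧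
        HermitianOrthogonal (J q : TangentSpace I q →ₗ[ℝ] TangentSpace I q) (X q) (Y q) := by
  have normalize : ∀ (X : ∀ p : M, TangentSpace I p), ‖X p‖ = 1 →
      (∀ᶠ q in 𝓝 p, SmoothFieldAt I X q) → ∀ᶠ q in 𝓝 p,
        SmoothFieldAt I (fun q => ‖X q‖⁻¹ • X q) q ∧ ‖‖X q‖⁻¹ • X q‖ = 1 := by
    intro X hXp hX
    have h1 : ∀ᶠ q in 𝓝 p, inner ℝ (X q) (X q) ≠ (0 : ℝ) :=
      (hX.self_of_nhds.inner hX.self_of_nhds).continuousAt.eventually_ne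
        (by rw [real_inner_self_eq_norm_sq, hXp]; norm_num)
    filter_upwards [h1, hX] with q hq hXq
    have h0 : X q ≠ 0 := fun h => hq (by simp [h])
    exact ⟨hXq.normalize h0, norm_smul_inv_norm (𝕜 := ℝ) h0⟩
  have proj : ∀ {q : M} {A B : ∀ p : M, TangentSpace I p}, SmoothFieldAt I A q →
      SmoothFieldAt I B q → SmoothFieldAt I (fun q => hermitianProj
        (J q : TangentSpace I q →ₗ[ℝ] TangentSpace I q) (A q) (B q)) q := by
    intro q A B hA hB
    have hJA := hA.almostComplex hJ
    exact hB.sub (((hA.inner hB).smul_section hA).add_section ((hJA.inner hB).smul_section hJA))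
  let W0 : ∀ p : M, TangentSpace I p := FiberBundle.extend E w
  let W : ∀ p : M, TangentSpace I p := fun q => ‖W0 q‖⁻¹ • W0 q
  let X0 : ∀ p : M, TangentSpace I p := fun q => hermitianProj
    (J q : TangentSpace I q →ₗ[ℝ] TangentSpace I q) (W q) (FiberBundle.extend E x q)
  let X : ∀ p : M, TangentSpace I p := fun q => ‖X0 q‖⁻¹ • X0 q
  let Y0 : ∀ p : M, TangentSpace I p := fun q => hermitianProj
    (J q : TangentSpace I q →ₗ[ℝ] TangentSpace I q) (X q) (hermitianProj
    (J q : TangentSpace I q →ₗ[ℝ] TangentSpace I q) (W q) (FiberBundle.extend E y q))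
  let Y : ∀ p : M, TangentSpace I p := fun q => ‖Y0 q‖⁻¹ • Y0 q
  have hW0p : W0 p = w := FiberBundle.extend_apply_self E w
  have hWp : W p = w := by simp [W, hW0p, hw]
  have hX0p : X0 p = x := by simp only [X0, hWp, FiberBundle.extend_apply_self, hwx.proj_eq]
  have hXp : X p = x := by simp [X, hX0p, hx]
  have hY0p : Y0 p = y := by
    simp only [Y0, hWp, hXp, FiberBundle.extend_apply_self, hwy.proj_eq, hxy.proj_eq]
  have hYp : Y p = y := by simp [Y, hY0p, hy]
  have eW := normalize W0 (by rw [hW0p, hw]) (eventually_smoothFieldAt_extend w)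
  have eX0 : ∀ᶠ q in 𝓝 p, SmoothFieldAt I X0 q := by
    filter_upwards [eW, eventually_smoothFieldAt_extend x] with q h1 h2
    exact proj h1.1 h2
  have eX := normalize X0 (by rw [hX0p, hx]) eX0
  have eY0 : ∀ᶠ q in 𝓝 p, SmoothFieldAt I Y0 q := by
    filter_upwards [eW, eX, eventually_smoothFieldAt_extend y] with q h1 h2 h3
    exact proj h2.1 (proj h1.1 h3)
  have eY := normalize Y0 (by rw [hY0p, hy]) eY0
  refine ⟨W, X, Y, hWp, hXp, hYp, ?_⟩
  filter_upwards [eW, eX, eY] with q h1 h2 h3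
  have hJq := hJ.isOrthogonalComplexStructure q
  have hWX : HermitianOrthogonal (J q : TangentSpace I q →ₗ[ℝ] TangentSpace I q) (W q) (X q) :=
    (hJq.hermitianOrthogonal_proj h1.2 _).smul_right _
  exact ⟨h1.1, h2.1, h3.1, h1.2, h2.2, h3.2, hWX,
    (hWX.proj_right hJq (hJq.hermitianOrthogonal_proj h1.2 _)).smul_right _,
    (hJq.hermitianOrthogonal_proj h2.2 _).smul_right _⟩

end AntiholomorphicCurvature

section SchurTheorem

set_option linter.unusedSectionVars false

variable {E : Type*} [NormedAddCommGroup E] [NormedSpace ℝ E] [FiniteDimensional ℝ E]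
  {H : Type*} [TopologicalSpace H] {I : ModelWithCorners ℝ E H}
  {M : Type*} [TopologicalSpace M] [ChartedSpace H M] [IsManifold I ∞ M]

open Filter Topology VectorField

theorem exists_eq_const_of_mvfderiv_eq_zero [I.Boundaryless] [ConnectedSpace M] {ν : M → ℝ}
    (h1 : ∀ p, MDifferentiableAt I 𝓘(ℝ) ν p) (h2 : ∀ p, mvfderiv I ν p = 0) :
    ∃ c : ℝ, ∀ p : M, ν p = c := by
  have h3 : ∀ p, mfderiv I 𝓘(ℝ) ν p = 0 := fun p => by
    ext v
    exact congrArg (fun L => L v) (h2 p)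
  have hloc : IsLocallyConstant ν := by
    rw [IsLocallyConstant.iff_eventually_eq]
    intro p
    let φ := extChartAt I p
    obtain ⟨r, hr, hball⟩ := Metric.isOpen_iff.1 (isOpen_extChartAt_target (I := I) p) (φ p)
      (mem_extChartAt_target p)
    have hsymm : ∀ y ∈ Metric.ball (φ p) r, MDifferentiableAt 𝓘(ℝ, E) I φ.symm y := fun y hy =>
      ((contMDiffOn_extChartAt_symm (n := ∞) p).contMDiffAt
        ((isOpen_extChartAt_target (I := I) p).mem_nhds (hball hy))).mdifferentiableAt (by simp)
    have hd : DifferentiableOn ℝ (ν ∘ φ.symm) (Metric.ball (φ p) r) := fun y hy =>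
      (((h1 _).comp y (hsymm y hy)).differentiableAt).differentiableWithinAt
    have hz : (Metric.ball (φ p) r).EqOn (fderiv ℝ (ν ∘ φ.symm)) 0 := fun y hy => by
      rw [← mfderiv_eq_fderiv, mfderiv_comp y (h1 _) (hsymm y hy), h3]
      ext v; simp; rfl
    have hU : φ ⁻¹' Metric.ball (φ p) r ∩ φ.source ∈ 𝓝 p :=
      inter_mem ((continuousAt_extChartAt p).preimage_mem_nhds (Metric.ball_mem_nhds _ hr))
        (extChartAt_source_mem_nhds p)
    filter_upwards [hU] with q hq
    have := Metric.isOpen_ball.is_const_of_fderiv_eq_zero (convex_ball (φ p) r).isPreconnected hd hz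
      hq.1 (Metric.mem_ball_self hr)
    simpa [φ.left_inv hq.2, φ.left_inv (mem_extChartAt_source p)] using this
  obtain ⟨c, hc⟩ := hloc.exists_eq_const
  exact ⟨c, fun p => congrFun hc p⟩

variable [Bundle.RiemannianBundle (fun p : M => TangentSpace I p)]
  [IsContMDiffRiemannianBundle I ∞ E (fun p : M => TangentSpace I p)] [Nontrivial E]
  {J : ∀ p : M, TangentSpace I p →L[ℝ] TangentSpace I p} {ν : M → ℝ}

theorem mvfderiv_eq_zero_of_eventually_const {f : M → ℝ} {p : M} {c : ℝ} (h : ∀ᶠ q in 𝓝 p, f q = c) :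
    mvfderiv I f p = 0 := by
  rw [mvfderiv_congr (h := fun _ => c) h, mvfderiv_const]

/-- A combination of the second Bianchi identity with metric compatibility. -/
theorem second_bianchi_inner {W X Y Z V : ∀ p : M, TangentSpace I p} {p : M}
    (hW : SmoothFieldAt I W p) (hX : SmoothFieldAt I X p) (hY : SmoothFieldAt I Y p)
    (hZ : SmoothFieldAt I Z p) (hV : SmoothFieldAt I V p) :
    (mvfderiv I (fun q => inner ℝ (curvatureOperator I X Y Z q) (V q)) p (W p)
      - curvatureTensor I (X p) (Y p) (Z p) (leviCivita I W V p)
      - curvatureTensor I (X p) (Y p) (leviCivita I W Z p) (V p)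
      + curvatureTensor I (W p) (mlieBracket I X Y p) (Z p) (V p))
    + (mvfderiv I (fun q => inner ℝ (curvatureOperator I Y W Z q) (V q)) p (X p)
      - curvatureTensor I (Y p) (W p) (Z p) (leviCivita I X V p)
      - curvatureTensor I (Y p) (W p) (leviCivita I X Z p) (V p)
      + curvatureTensor I (X p) (mlieBracket I Y W p) (Z p) (V p))
    + (mvfderiv I (fun q => inner ℝ (curvatureOperator I W X Z q) (V q)) p (Y p)
      - curvatureTensor I (W p) (X p) (Z p) (leviCivita I Y V p)
      - curvatureTensor I (W p) (X p) (leviCivita I Y Z p) (V p)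
      + curvatureTensor I (Y p) (mlieBracket I W X p) (Z p) (V p)) = 0 := by
  have key : ∀ {A B C : ∀ p : M, TangentSpace I p}, SmoothFieldAt I A p → SmoothFieldAt I B p →
      SmoothFieldAt I C p →
      inner ℝ (leviCivita I A (curvatureOperator I B C Z) p
        - curvatureOperator I B C (leviCivita I A Z) p
        + curvatureOperator I A (mlieBracket I B C) Z p) (V p) =
      mvfderiv I (fun q => inner ℝ (curvatureOperator I B C Z q) (V q)) p (A p)
      - curvatureTensor I (B p) (C p) (Z p) (leviCivita I A V p)
      - curvatureTensor I (B p) (C p) (leviCivita I A Z p) (V p)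
      + curvatureTensor I (A p) (mlieBracket I B C p) (Z p) (V p) := by
    intro A B C hA hB hC
    rw [inner_add_left, inner_sub_left, leviCivita_metric hA.diffFieldAt
      (hB.curvatureOperator hC hZ).diffFieldAt hV.diffFieldAt, inner_curvatureOperator hB hC hZ,
      inner_curvatureOperator hB hC (hA.leviCivita hZ),
      inner_curvatureOperator hA (hB.mlieBracket hC) hZ]
    ring
  rw [← key hW hX hY, ← key hX hY hW, ← key hY hW hX, ← inner_add_left, ← inner_add_left,
    second_bianchi hW hX hY hZ, inner_zero_left]

theorem leviCivita_inner_eq_neg {A X Y : ∀ p : M, TangentSpace I p} {p : M} {c : ℝ}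
    (hA : SmoothFieldAt I A p) (hX : SmoothFieldAt I X p) (hY : SmoothFieldAt I Y p)
    (h : ∀ᶠ q in 𝓝 p, inner ℝ (X q) (Y q) = c) :
    inner ℝ (leviCivita I A X p) (Y p) = - inner ℝ (leviCivita I A Y p) (X p) := by
  have h1 := leviCivita_metric hA.diffFieldAt hX.diffFieldAt hY.diffFieldAt
  rw [mvfderiv_eq_zero_of_eventually_const h, zero_apply,
    real_inner_comm _ (X p)] at h1
  linarith

theorem HasPointwiseConstantAntiholomorphicCurvature.mvfderiv_apply_eq_zero
    (hE : 6 ≤ Module.finrank ℝ E) (hJ : IsAlmostHermitian I J)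
    (hν : HasPointwiseConstantAntiholomorphicCurvature I J ν) {p : M} {w : TangentSpace I p}
    (hw : ‖w‖ = 1) : MDifferentiableAt I 𝓘(ℝ) ν p ∧ mvfderiv I ν p w = 0 := by
  have hJp := hJ.isOrthogonalComplexStructure p
  have hRp := isCurvatureLike_curvatureTensor (I := I) p
  have hR' := hRp.sub_constant (ν p)
  set R' : TangentSpace I p → TangentSpace I p → TangentSpace I p → TangentSpace I p → ℝ :=
    fun x y z u => curvatureTensor I x y z u - ν p * constantCurvatureTensor x y z u with hR'def
  have h0 : VanishesOnAntiholomorphic (J p : TangentSpace I p →ₗ[ℝ] TangentSpace I p) R' :=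
    hν.vanishes hJ p
  obtain ⟨x, y, hx, hy, hwx, hwy, hxy, fx, fy, fxy⟩ := exists_isotropic_pair hJp
    (V := TangentSpace I p) hE (w := w)
    { toFun := fun v => R' w v w (J p w)
      map_add' := fun v v' => hR'.add_second _ _ _ _ _
      map_smul' := fun c v => hR'.smul_second _ _ _ _ _ }
    (LinearMap.mk₂ ℝ (fun u v => R' u v w (J p w)) (fun _ _ _ => hR'.add_first _ _ _ _ _)
      (fun _ _ _ => hR'.smul_first _ _ _ _ _) (fun _ _ _ => hR'.add_second _ _ _ _ _)
      (fun _ _ _ => hR'.smul_second _ _ _ _ _))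
  have V := fun d => h0.eq_zero_of_triple hJp hR' hwx hwy hxy hw hx hy fx fy fxy d
  obtain ⟨W, X, Y, rfl, rfl, rfl, hev⟩ := exists_adapted_fields hJ hw hx hy hwx hwy hxy
  obtain ⟨sW, sX, sY, -⟩ := hev.self_of_nhds
  have e1 : (fun q => inner ℝ (curvatureOperator I X Y Y q) (X q)) =ᶠ[𝓝 p] ν := by
    filter_upwards [hev] with q ⟨h1, h2, h3, h4, h5, h6, h7, h8, h9⟩
    rw [inner_curvatureOperator h2 h3 h3, hν.curvatureTensor_eq hJ h5 h6 h9]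
  have e2 : ∀ᶠ q in 𝓝 p, inner ℝ (curvatureOperator I Y W Y q) (X q) = 0 := by
    filter_upwards [hev] with q ⟨h1, h2, h3, h4, h5, h6, h7, h8, h9⟩
    have hJq := hJ.isOrthogonalComplexStructure q
    rw [inner_curvatureOperator h3 h1 h3]
    have hd := (hν.vanishes hJ q).diag ((isCurvatureLike_curvatureTensor q).sub_constant _) h8 h9
    have hs := (isCurvatureLike_curvatureTensor (I := I) q).swap_left (Y q) (W q) (Y q) (X q)
    simp only [constantCurvatureTensor, h7.1, h8.1] at hd hs
    linarith
  have e3 : ∀ᶠ q in 𝓝 p, inner ℝ (curvatureOperator I W X Y q) (X q) = 0 := by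
    filter_upwards [hev] with q ⟨h1, h2, h3, h4, h5, h6, h7, h8, h9⟩
    have hJq := hJ.isOrthogonalComplexStructure q
    rw [inner_curvatureOperator h1 h2 h3]
    have hd := (hν.vanishes hJ q).diag ((isCurvatureLike_curvatureTensor q).sub_constant _) h7
      (hJq.symm h9)
    have hs := (isCurvatureLike_curvatureTensor (I := I) q).swap_right (W q) (X q) (Y q) (X q)
    simp only [constantCurvatureTensor, h7.1, h8.1] at hd hs
    linarith
  refine ⟨(((sX.curvatureOperator sY sY).inner sX).congr_of_eventuallyEq
    e1.symm).mdifferentiableAt (by simp), ?_⟩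
  have key := second_bianchi_inner sW sX sY sY sX
  rw [mvfderiv_congr e1, mvfderiv_eq_zero_of_eventually_const e2,
    mvfderiv_eq_zero_of_eventually_const e3] at key
  have c : ∀ {A B : ∀ p : M, TangentSpace I p}, SmoothFieldAt I A p → SmoothFieldAt I B p →
      (∀ᶠ q in 𝓝 p, ‖B q‖ = 1) → inner ℝ (leviCivita I A B p) (B p) = 0 := by
    intro A B hA hB h
    have := leviCivita_inner_eq_neg (c := 1) hA hB hB (h.mono fun q hq => by
      rw [real_inner_self_eq_norm_sq, hq]; norm_num)
    linarith
  have m1 := c sW sX (hev.mono fun q hq => hq.2.2.2.2.1)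
  have m2 := c sW sY (hev.mono fun q hq => hq.2.2.2.2.2.1)
  have m3 := leviCivita_inner_eq_neg (c := 0) sX sX sW (hev.mono fun q hq => by
    rw [real_inner_comm]; exact hq.2.2.2.2.2.2.1.1)
  have m4 := leviCivita_inner_eq_neg (c := 0) sY sY sW (hev.mono fun q hq => by
    rw [real_inner_comm]; exact hq.2.2.2.2.2.2.2.1.1)
  have t1 := congrArg (fun v => inner ℝ v (X p)) (leviCivita_torsion sW.diffFieldAt sX.diffFieldAt)
  have t2 := congrArg (fun v => inner ℝ v (Y p)) (leviCivita_torsion sY.diffFieldAt sW.diffFieldAt)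
  simp only [inner_sub_left] at t1 t2
  have hww : inner ℝ (W p) (W p) = (1 : ℝ) := by rw [real_inner_self_eq_norm_sq, hw]; norm_num
  have hxx : inner ℝ (X p) (X p) = (1 : ℝ) := by rw [real_inner_self_eq_norm_sq, hx]; norm_num
  have hyy : inner ℝ (Y p) (Y p) = (1 : ℝ) := by rw [real_inner_self_eq_norm_sq, hy]; norm_num
  have hxw : inner ℝ (X p) (W p) = (0 : ℝ) := by rw [real_inner_comm]; exact hwx.1
  have hyw : inner ℝ (Y p) (W p) = (0 : ℝ) := by rw [real_inner_comm]; exact hwy.1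
  have hyx : inner ℝ (Y p) (X p) = (0 : ℝ) := by rw [real_inner_comm]; exact hxy.1
  -- the curvature components at `p`
  have k1 := (V (leviCivita I W X p)).2.2.2.2.1
  have k2 := (V (leviCivita I W Y p)).2.2.2.2.2.1
  have k3 := (V (mlieBracket I X Y p)).2.2.2.2.2.2.2.1
  have k4 := (V (leviCivita I X X p)).2.2.1
  have k5 := (V (leviCivita I X Y p)).2.2.2.2.2.2.2.2
  have k6 := (V (mlieBracket I Y W p)).2.2.2.2.2.1
  have k7 := (V (leviCivita I Y X p)).2.2.2.2.2.2.1
  have k8 := (V (leviCivita I Y Y p)).1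
  have k9 := (V (mlieBracket I W X p)).2.2.2.2.1
  simp only [hR'def, constantCurvatureTensor, hxx, hyy, hxw, hyw, hyx, hwx.1, hwy.1,
    hxy.1] at k1 k2 k3 k4 k5 k6 k7 k8 k9
  have s2 := hRp.swap_left (Y p) (X p) (X p) (leviCivita I W Y p)
  have s2' := hRp.swap_right (X p) (Y p) (X p) (leviCivita I W Y p)
  have s3 := hRp.pair_symm (W p) (mlieBracket I X Y p) (Y p) (X p)
  have s3' := hRp.swap_left (X p) (Y p) (W p) (mlieBracket I X Y p)
  have s4 := hRp.swap_left (Y p) (W p) (Y p) (leviCivita I X X p)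
  have s5 := hRp.swap_right (Y p) (W p) (X p) (leviCivita I X Y p)
  have s6 := hRp.pair_symm (X p) (mlieBracket I Y W p) (Y p) (X p)
  have s8 := hRp.swap_right (W p) (X p) (X p) (leviCivita I Y Y p)
  have s9 := hRp.pair_symm (Y p) (mlieBracket I W X p) (Y p) (X p)
  have s9' := hRp.swap_left (X p) (Y p) (Y p) (mlieBracket I W X p)
  have a1 : inner ℝ (X p) (leviCivita I W X p) = (0 : ℝ) := by rw [real_inner_comm, m1]
  have a2 : inner ℝ (Y p) (leviCivita I W Y p) = (0 : ℝ) := by rw [real_inner_comm, m2]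
  have a6 : inner ℝ (Y p) (mlieBracket I Y W p) = - inner ℝ (W p) (leviCivita I Y Y p) := by
    rw [real_inner_comm, real_inner_comm _ (W p)]
    linarith
  have a9 : inner ℝ (X p) (mlieBracket I W X p) = inner ℝ (W p) (leviCivita I X X p) := by
    rw [real_inner_comm, real_inner_comm _ (W p)]
    linarith
  rw [a1] at k1
  rw [a2] at k2
  rw [a6] at k6
  rw [a9] at k9
  rw [zero_apply, zero_apply] at key
  linarith

end SchurTheorem

theorem mainTheorem1 (n : ℕ) (hn : 3 ≤ n)
    {M : Type*} [TopologicalSpace M] [T2Space M] [ConnectedSpace M]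
    [ChartedSpace (EuclideanSpace ℝ (Fin (2 * n))) M] [IsManifold (𝓡 (2 * n)) ∞ M]
    [Bundle.RiemannianBundle (fun p : M => TangentSpace (𝓡 (2 * n)) p)]
    [IsContMDiffRiemannianBundle (𝓡 (2 * n)) ∞ (EuclideanSpace ℝ (Fin (2 * n)))
      (fun p : M => TangentSpace (𝓡 (2 * n)) p)]
    (J : ∀ p : M, TangentSpace (𝓡 (2 * n)) p →L[ℝ] TangentSpace (𝓡 (2 * n)) p)
    (hJ : IsAlmostHermitian (𝓡 (2 * n)) J)
    (ν : M → ℝ)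
    (hν : HasPointwiseConstantAntiholomorphicCurvature (𝓡 (2 * n)) J ν) :
    ∃ c : ℝ, ∀ p : M, ν p = c := by
  have hE : 6 ≤ Module.finrank ℝ (EuclideanSpace ℝ (Fin (2 * n))) := by
    rw [finrank_euclideanSpace_fin]
    omega
  have : Nontrivial (EuclideanSpace ℝ (Fin (2 * n))) :=
    Module.nontrivial_of_finrank_pos (R := ℝ) (by omega)
  have unit : ∀ (p : M) (v : TangentSpace (𝓡 (2 * n)) p), v ≠ 0 → ‖‖v‖⁻¹ • v‖ = 1 :=
    fun p v hv => norm_smul_inv_norm (𝕜 := ℝ) hv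
  refine exists_eq_const_of_mvfderiv_eq_zero (I := 𝓡 (2 * n)) (fun p => ?_) fun p => ?_
  · have : Nontrivial (TangentSpace (𝓡 (2 * n)) p) :=
      inferInstanceAs (Nontrivial (EuclideanSpace ℝ (Fin (2 * n))))
    obtain ⟨v, hv⟩ := exists_ne (0 : TangentSpace (𝓡 (2 * n)) p)
    exact (hν.mvfderiv_apply_eq_zero hE hJ (unit p v hv)).1
  · ext v
    by_cases hv : v = 0
    · rw [hv, map_zero, map_zero]
    · have h := (hν.mvfderiv_apply_eq_zero hE hJ (unit p v hv)).2
      rw [map_smul, smul_eq_zero, inv_eq_zero, norm_eq_zero] at h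
      exact h.resolve_left hv
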